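/- Let $m \ge 1$, let $M$ be a nonempty $m$-dimensional Riemannian manifold, let $Q$ be an $(m+1)$-dimensional Riemannian manifold (both smooth, without boundary), and let $\iota \colon M \to Q$ be a smooth isometric immersion, so that $M$ is an immersed hypersurface of $Q$. Denote by $\nabla$ and $\widetilde{\nabla}$ the Levi-Civita connections of $M$ and $Q$, by $\alpha$ the second fundamental form of $\iota$ (so $\alpha(X,Y)$ is the component of $\widetilde{\nabla}_X Y$ normal to $M$), by $\nabla^{\perp}$ the normal connection, and by $H = m^{-1}\operatorname{tr}(\alpha)$ the mean curvature vector. Let $I \subset \mathbb{R}$ be an open interval. A smooth unit-speed curve $\beta \colon I \to Q$ with tangent vector $T=\beta'$ is called planar if there are a smooth unit vector field $Y$ along $\beta$ and a smooth function $\kappa \colon I \to \mathbb{R}$ such that $$\widetilde{\nabla}_T T = \kappa Y, \qquad \widetilde{\nabla}_T Y = -\kappa T ;$$ it is called a circle if this holds with $\kappa$ a positive constant. The extrinsic shape of a curve $\gamma$ in $M$ is the curve $\iota\circ\gamma$ in $Q$. The immersion $\iota$ is totally umbilic if, at every point and for every normal vector $\eta$ there, the shape operator $A_\eta$ (the tangential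 component of $X \mapsto \widetilde{\nabla}_X N$, for $N$ a normal vector field extending $\eta$) is a multiple of the identity; it is an extrinsic sphere if it is totally umbilic and $\nabla^{\perp}_X H = 0$ for every $X$ tangent to $M$; it is totally geodesic if $\alpha$ vanishes identically. 1. If the extrinsic shape of every unit-speed geodesic $\gamma \colon I \to M$, $I$ an open interval, is planar, then $\iota$ is totally umbilic. 2. If the extrinsic shape of every unit-speed geodesic $\gamma \colon I \to M$, $I$ an open interval, is a circle, then $\iota$ is an extrinsic sphere and is not totally geodesic. -/

import Mathlib

open Bundle Manifold
open scoped ContDiff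

noncomputable section

namespace PlanarGeodesics

section OneManifold

variable {E : Type*} [NormedAddCommGroup E] [NormedSpace ℝ E]
  {M : Type*} [TopologicalSpace M] [ChartedSpace E M]

instance finiteDimensional_tangentSpace [FiniteDimensional ℝ E] (x : M) :
    FiniteDimensional ℝ (TangentSpace 𝓘(ℝ, E) x) :=
  inferInstanceAs (FiniteDimensional ℝ E)

variable [FiniteDimensional ℝ E] [IsManifold 𝓘(ℝ, E) ∞ M]
  [RiemannianBundle (fun x : M ↦ TangentSpace 𝓘(ℝ, E) x)]

/-- For tangent vectors `u`, `v`, `w` at `x`, the derivative at `x` in the direction `u` of the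
function `⟨V, W⟩`, where `V`, `W` are the vector fields near `x` which extend `v`, `w` and have
constant components in the preferred chart at `x` (this is what `FiberBundle.extend` is for the
tangent bundle). With coordinate vectors this is the usual `∂ᵢ gⱼₖ` at `x`. -/
def metricDeriv (x : M) (u v w : TangentSpace 𝓘(ℝ, E) x) : ℝ :=
  mvfderiv 𝓘(ℝ, E)
    (fun q : M ↦ inner ℝ
      (FiberBundle.extend E v q : TangentSpace 𝓘(ℝ, E) q)
      (FiberBundle.extend E w q : TangentSpace 𝓘(ℝ, E) q)) x u

/-- The Christoffel symbol at `x` of the Levi-Civita connection in the preferred chart at `x`,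
written as a vector-valued bilinear map: `Γ(u, v)` is the vector with
`2⟨Γ(u, v), w⟩ = u⟨V, W⟩ + v⟨U, W⟩ - w⟨U, V⟩` for all `w` (Koszul's formula for the commuting
vector fields `U`, `V`, `W` with constant components in the chart), expanded in an
orthonormal basis of the tangent space. -/
def christoffel (x : M) (u v : TangentSpace 𝓘(ℝ, E) x) : TangentSpace 𝓘(ℝ, E) x :=
  ∑ i, ((metricDeriv x u v (stdOrthonormalBasis ℝ (TangentSpace 𝓘(ℝ, E) x) i)
      + metricDeriv x v u (stdOrthonormalBasis ℝ (TangentSpace 𝓘(ℝ, E) x) i)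
      - metricDeriv x (stdOrthonormalBasis ℝ (TangentSpace 𝓘(ℝ, E) x) i) u v) / 2) •
    stdOrthonormalBasis ℝ (TangentSpace 𝓘(ℝ, E) x) i

section AlongMap

variable {F : Type*} [NormedAddCommGroup F] [NormedSpace ℝ F]
  {N : Type*} [TopologicalSpace N] [ChartedSpace F N]

/-- The covariant derivative at `p`, in the direction `v` tangent to `N`, of a vector field `V`
along a map `f : N → M` into a Riemannian manifold, with respect to the Levi-Civita connection
of `M`. In the preferred chart of `M` at `f p` it is `v(Vᵏ) + Γᵏᵢⱼ (df v)ⁱ Vʲ`. For `N = ℝ` it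
is the covariant derivative along a curve. -/
def covDeriv (f : N → M) (V : ∀ q : N, TangentSpace 𝓘(ℝ, E) (f q)) (p : N)
    (v : TangentSpace 𝓘(ℝ, F) p) : TangentSpace 𝓘(ℝ, E) (f p) :=
  (trivializationAt E (TangentSpace 𝓘(ℝ, E) : M → Type _) (f p)).symm (f p)
    (mvfderiv 𝓘(ℝ, F)
      (fun q : N ↦ (trivializationAt E (TangentSpace 𝓘(ℝ, E) : M → Type _) (f p)
        (⟨f q, V q⟩ : TangentBundle 𝓘(ℝ, E) M)).2) p v)
  + christoffel (f p) (mfderiv 𝓘(ℝ, F) 𝓘(ℝ, E) f p v) (V p)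

end AlongMap

/-- The velocity field `T = γ'` of a curve. -/
def velocity (γ : ℝ → M) (t : ℝ) : TangentSpace 𝓘(ℝ, E) (γ t) :=
  mfderiv 𝓘(ℝ, ℝ) 𝓘(ℝ, E) γ t (1 : ℝ)

/-- The covariant derivative `∇_T V` of a vector field along a curve. -/
def covDerivCurve (γ : ℝ → M) (V : ∀ t : ℝ, TangentSpace 𝓘(ℝ, E) (γ t)) (t : ℝ) :
    TangentSpace 𝓘(ℝ, E) (γ t) :=
  covDeriv (N := ℝ) (F := ℝ) γ V t (1 : ℝ)

/-- The curve `γ` is smooth and of unit speed on `J`. -/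
def IsUnitSpeedOn (γ : ℝ → M) (J : Set ℝ) : Prop :=
  ContMDiffOn 𝓘(ℝ, ℝ) 𝓘(ℝ, E) ∞ γ J ∧
    ∀ t ∈ J, inner ℝ (velocity (E := E) γ t) (velocity (E := E) γ t) = 1

/-- The curve `γ` is a unit-speed geodesic on `J`. -/
def IsGeodesicOn (γ : ℝ → M) (J : Set ℝ) : Prop :=
  IsUnitSpeedOn (E := E) γ J ∧ ∀ t ∈ J, covDerivCurve (E := E) γ (velocity γ) t = 0

/-- The unit-speed curve `γ` satisfies, on `J`, the system `∇_T T = κ Y`, `∇_T Y = -κ T` for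
some smooth unit vector field `Y` along `γ`. -/
def SatisfiesPlanarSystem (γ : ℝ → M) (J : Set ℝ) (κ : ℝ → ℝ) : Prop :=
  IsUnitSpeedOn (E := E) γ J ∧
    ∃ Y : ∀ t : ℝ, TangentSpace 𝓘(ℝ, E) (γ t),
      ContMDiffOn 𝓘(ℝ, ℝ) 𝓘(ℝ, E).tangent ∞
        (fun t ↦ (⟨γ t, Y t⟩ : TangentBundle 𝓘(ℝ, E) M)) J ∧
      ∀ t ∈ J, inner ℝ (Y t) (Y t) = 1 ∧
        covDerivCurve γ (velocity γ) t = κ t • Y t ∧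
        covDerivCurve γ Y t = -(κ t • velocity γ t)

/-- The curve `γ` is planar on `J`. -/
def IsPlanarOn (γ : ℝ → M) (J : Set ℝ) : Prop :=
  ∃ κ : ℝ → ℝ, ContDiffOn ℝ ∞ κ J ∧ SatisfiesPlanarSystem (E := E) γ J κ

/-- The curve `γ` is a (Riemannian) circle on `J`: planar with constant `κ > 0`. -/
def IsCircleOn (γ : ℝ → M) (J : Set ℝ) : Prop :=
  ∃ c : ℝ, 0 < c ∧ SatisfiesPlanarSystem (E := E) γ J (fun _ ↦ c)

end OneManifold

section Immersion

variable {E : Type*} [NormedAddCommGroup E] [NormedSpace ℝ E] [FiniteDimensional ℝ E]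
  {M : Type*} [TopologicalSpace M] [ChartedSpace E M] [IsManifold 𝓘(ℝ, E) ∞ M]
  [RiemannianBundle (fun x : M ↦ TangentSpace 𝓘(ℝ, E) x)]
  {F : Type*} [NormedAddCommGroup F] [NormedSpace ℝ F] [FiniteDimensional ℝ F]
  {Q : Type*} [TopologicalSpace Q] [ChartedSpace F Q] [IsManifold 𝓘(ℝ, F) ∞ Q]
  [RiemannianBundle (fun x : Q ↦ TangentSpace 𝓘(ℝ, F) x)]

/-- A smooth isometric immersion between Riemannian manifolds: the metric of `M` is the pull-back
of that of `Q`, so that the differential is automatically injective. -/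
def IsIsometricImmersion (ι : M → Q) : Prop :=
  ContMDiff 𝓘(ℝ, E) 𝓘(ℝ, F) ∞ ι ∧
    ∀ (p : M) (x y : TangentSpace 𝓘(ℝ, E) p),
      inner ℝ (mfderiv 𝓘(ℝ, E) 𝓘(ℝ, F) ι p x) (mfderiv 𝓘(ℝ, E) 𝓘(ℝ, F) ι p y) = inner ℝ x y

/-- The image of the tangent space of `M` at `p`, inside the tangent space of `Q` at `ι p`. -/
def tangentRange (ι : M → Q) (p : M) : Submodule ℝ (TangentSpace 𝓘(ℝ, F) (ι p)) :=
  LinearMap.range (mfderiv 𝓘(ℝ, E) 𝓘(ℝ, F) ι p).toLinearMap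

/-- The normal space of the immersion at `p`. -/
def normalSpace (ι : M → Q) (p : M) : Submodule ℝ (TangentSpace 𝓘(ℝ, F) (ι p)) :=
  (tangentRange (E := E) ι p)ᗮ

/-- The orthogonal projection onto the tangent part. -/
def tangentPart (ι : M → Q) (p : M) (v : TangentSpace 𝓘(ℝ, F) (ι p)) :
    TangentSpace 𝓘(ℝ, F) (ι p) :=
  (tangentRange (E := E) ι p).starProjection v

/-- The orthogonal projection onto the normal part. -/
def normalPart (ι : M → Q) (p : M) (v : TangentSpace 𝓘(ℝ, F) (ι p)) :
    TangentSpace 𝓘(ℝ, F) (ι p) :=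
  v - tangentPart (E := E) ι p v

/-- The second fundamental form `α(x, y)`: the normal part of the covariant derivative in the
direction `x` of the vector field `dι(Y)` along `ι`, where `Y` is a local extension of `y`
(the result does not depend on the extension). -/
def secondFundamentalForm (ι : M → Q) (p : M) (x y : TangentSpace 𝓘(ℝ, E) p) :
    TangentSpace 𝓘(ℝ, F) (ι p) :=
  normalPart (E := E) ι p
    (covDeriv ι (fun q ↦ mfderiv 𝓘(ℝ, E) 𝓘(ℝ, F) ι q (FiberBundle.extend E y q)) p x)

/-- The shape operator `A_η(x)`: the tangent part of the covariant derivative in the direction `x`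
of a normal vector field along `ι` extending the normal vector `η`, here the normal part of a
local extension of `η` (the result does not depend on the extension). -/
def shapeOperator (ι : M → Q) (p : M) (η : TangentSpace 𝓘(ℝ, F) (ι p))
    (x : TangentSpace 𝓘(ℝ, E) p) : TangentSpace 𝓘(ℝ, F) (ι p) :=
  tangentPart (E := E) ι p
    (covDeriv ι (fun q ↦ normalPart (E := E) ι q (FiberBundle.extend F η (ι q))) p x)

/-- The immersion is umbilic at `p` in the direction of the normal vector `η`: the shape operator
`A_η` is a multiple of the identity of the tangent space (identified with its image by `dι`). -/
def IsUmbilicInDirection (ι : M → Q) (p : M) (η : TangentSpace 𝓘(ℝ, F) (ι p)) : Prop :=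
  ∃ c : ℝ, ∀ x : TangentSpace 𝓘(ℝ, E) p,
    shapeOperator ι p η x = c • mfderiv 𝓘(ℝ, E) 𝓘(ℝ, F) ι p x

variable (E F) in
/-- The immersion is totally umbilic: umbilic in every normal direction at every point. -/
def IsTotallyUmbilic (ι : M → Q) : Prop :=
  ∀ (p : M), ∀ η ∈ normalSpace (E := E) (F := F) ι p, IsUmbilicInDirection (E := E) ι p η

/-- The mean curvature vector `H = m⁻¹ tr α`, with `m = dim M`. -/
def meanCurvature (ι : M → Q) (p : M) : TangentSpace 𝓘(ℝ, F) (ι p) :=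
  (Module.finrank ℝ E : ℝ)⁻¹ • ∑ i, secondFundamentalForm ι p
    (stdOrthonormalBasis ℝ (TangentSpace 𝓘(ℝ, E) p) i)
    (stdOrthonormalBasis ℝ (TangentSpace 𝓘(ℝ, E) p) i)

/-- The normal connection: the normal part of the covariant derivative of a normal vector field
`η` along `ι`. -/
def normalCovDeriv (ι : M → Q) (η : ∀ q : M, TangentSpace 𝓘(ℝ, F) (ι q)) (p : M)
    (x : TangentSpace 𝓘(ℝ, E) p) : TangentSpace 𝓘(ℝ, F) (ι p) :=
  normalPart (E := E) ι p (covDeriv ι η p x)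

variable (E F) in
/-- An extrinsic sphere: totally umbilic, with mean curvature vector parallel in the normal
bundle. -/
def IsExtrinsicSphere (ι : M → Q) : Prop :=
  IsTotallyUmbilic E F ι ∧
    ∀ (p : M) (x : TangentSpace 𝓘(ℝ, E) p),
      normalCovDeriv (F := F) ι (meanCurvature (E := E) ι) p x = 0

variable (E F) in
/-- Totally geodesic: the second fundamental form vanishes identically. -/
def IsTotallyGeodesic (ι : M → Q) : Prop :=
  ∀ (p : M) (x y : TangentSpace 𝓘(ℝ, E) p), secondFundamentalForm (F := F) ι p x y = 0

end Immersion

end PlanarGeodesics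

end

/-!
# Hypersurfaces whose geodesics have planar or circular extrinsic shape

Let `γ` be a unit-speed geodesic of the hypersurface `M`, with velocity `T`. The acceleration of its
extrinsic shape is normal and equals `α(T, T)` (`covDerivCurve_velocity_immersion`). Suppose that
the extrinsic shape satisfies `∇_T T = κ Y`, `∇_T Y = -κ T`. Where `κ ≠ 0` the field `Y` is then a
unit normal field, and differentiating `⟨Y, W⟩ = 0` for tangential fields `W` gives
`⟨Y, α(T, W)⟩ = κ ⟨T, W⟩`. As the normal space is a line, this says that
`α(T, W) = ⟨T, W⟩ α(T, T)` (`normalPart_hess_of_satisfiesPlanarSystem`).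

Since there is a geodesic in each direction (`exists_geodesic`), at each point
`⟨v, v⟩ α(v, w) = ⟨v, w⟩ α(v, v)` for all `w` and all `v` with `α(v, v) ≠ 0`. Linear algebra
(`exists_eq_smul_of_forall_smul_eq`) shows that `α = ⟨·, ·⟩ H`, also when there are vectors with
`α(v, v) = 0`. By the Weingarten relation (`inner_shapeOperator`), the immersion is totally umbilic.

If the extrinsic shapes are circles, then the mean curvature vector is `H = α(T, T) = κ Y` along
`γ`, with `κ` constant, and `∇_T H = -κ² T` is tangential: `H` is parallel in the normal bundle
(`normalPart_covDeriv_meanCurvature`). Moreover `α(T, T) = κ Y ≠ 0`.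

The computations are made in the parametrization `f = ι ∘ chartParam E x₀` of `M` by the inverse of
a chart. The covariant derivative of the constant vector field `v`, that is, of `df(v)`, in the
direction `u` is the Hessian `hess f y u v`; its normal part is `α`, and its tangential part is
given by Koszul's formula (`inner_hess_eq_gram`) in terms of the pulled-back metric. The definition
of `covDeriv` at a point refers to the preferred chart there; the product rule for the metric
(`fderiv_inner_eq_covDeriv`), the symmetry of the Hessian and Koszul's formula, which hold in every
chart, are what makes the results for different points fit together.
-/

noncomputable section

set_option linter.unusedSectionVars false

namespace PlanarGeodesics

open Filter Topology Set

/-! ### Components of vector fields along a map -/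

section Along

variable {E : Type*} [NormedAddCommGroup E] [NormedSpace ℝ E]
  {X : Type*} [TopologicalSpace X] [ChartedSpace E X]
  {N : Type*} [NormedAddCommGroup N] [NormedSpace ℝ N]

/-- The differential of a map defined on a normed space. It is `mfderiv`, with domain the normed
space itself in place of its tangent space at `p`, so that the linear structure of the domain can be
used without identifications. -/
def differential (f : N → X) (p : N) : N →L[ℝ] TangentSpace 𝓘(ℝ, E) (f p) :=
  mfderiv 𝓘(ℝ, N) 𝓘(ℝ, E) f p

variable [IsManifold 𝓘(ℝ, E) ∞ X]

/-- The components of a tangent vector at `q` in the preferred chart at `x₀`. This is the identity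
for `q = x₀`; outside of the chart it has the junk value `0`. -/
def toCoord (x₀ q : X) : TangentSpace 𝓘(ℝ, E) q →L[ℝ] E :=
  (trivializationAt E (TangentSpace 𝓘(ℝ, E) : X → Type _) x₀).continuousLinearMapAt ℝ q

/-- The tangent vector at `q` with given components in the preferred chart at `x₀`, the inverse of
`toCoord x₀ q` for `q` in the chart. -/
def ofCoord (x₀ q : X) : E →L[ℝ] TangentSpace 𝓘(ℝ, E) q :=
  (trivializationAt E (TangentSpace 𝓘(ℝ, E) : X → Type _) x₀).symmL ℝ q

lemma trivializationAt_snd {x₀ q : X} (hq : q ∈ (chartAt E x₀).source)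
    (v : TangentSpace 𝓘(ℝ, E) q) :
    (trivializationAt E (TangentSpace 𝓘(ℝ, E) : X → Type _) x₀
      (⟨q, v⟩ : TangentBundle 𝓘(ℝ, E) X)).2 = toCoord x₀ q v := by
  rw [toCoord, Trivialization.continuousLinearMapAt_apply, Trivialization.linearMapAt_apply, if_pos]
  exact hq

lemma trivializationAt_symm {x₀ q : X} (hq : q ∈ (chartAt E x₀).source) (v : E) :
    (trivializationAt E (TangentSpace 𝓘(ℝ, E) : X → Type _) x₀).symm q v = ofCoord x₀ q v := by
  rw [ofCoord, Trivialization.symmL_apply _ hq]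

lemma ofCoord_toCoord {x₀ q : X} (hq : q ∈ (chartAt E x₀).source)
    (v : TangentSpace 𝓘(ℝ, E) q) : ofCoord x₀ q (toCoord x₀ q v) = v :=
  (trivializationAt E (TangentSpace 𝓘(ℝ, E) : X → Type _) x₀).symmL_continuousLinearMapAt hq v

lemma toCoord_ofCoord {x₀ q : X} (hq : q ∈ (chartAt E x₀).source)
    (v : E) : toCoord x₀ q (ofCoord x₀ q v) = v :=
  (trivializationAt E (TangentSpace 𝓘(ℝ, E) : X → Type _) x₀).continuousLinearMapAt_symmL hq v

lemma toCoord_eq_mfderiv {x₀ q : X} (hq : q ∈ (chartAt E x₀).source)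
    (v : TangentSpace 𝓘(ℝ, E) q) :
    toCoord x₀ q v = mfderiv 𝓘(ℝ, E) 𝓘(ℝ, E) (extChartAt 𝓘(ℝ, E) x₀) q v :=
  congrArg (fun L => L v) (TangentBundle.continuousLinearMapAt_trivializationAt hq)

lemma fderiv_extChartAt_comp {f : N → X} {x₀ : X} {p : N} (hp : f p ∈ (chartAt E x₀).source)
    (hf : MDifferentiableAt 𝓘(ℝ, N) 𝓘(ℝ, E) f p) (v : N) :
    fderiv ℝ (extChartAt 𝓘(ℝ, E) x₀ ∘ f) p v = toCoord x₀ (f p) (differential f p v) := by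
  rw [toCoord_eq_mfderiv hp, ← mfderiv_eq_fderiv,
    mfderiv_comp p (mdifferentiableAt_extChartAt hp) hf]
  rfl

lemma differentiableAt_extChartAt_comp {f : N → X} {x₀ : X} {p : N}
    (hp : f p ∈ (chartAt E x₀).source)
    (hf : MDifferentiableAt 𝓘(ℝ, N) 𝓘(ℝ, E) f p) :
    DifferentiableAt ℝ (extChartAt 𝓘(ℝ, E) x₀ ∘ f) p :=
  mdifferentiableAt_iff_differentiableAt.1 ((mdifferentiableAt_extChartAt hp).comp p hf)

/-- The components, in the preferred chart at `x₀`, of a vector field `V` along the map `f`. -/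
def vecRep (x₀ : X) (f : N → X) (V : ∀ q : N, TangentSpace 𝓘(ℝ, E) (f q)) (q : N) : E :=
  toCoord x₀ (f q) (V q)

lemma vecRep_eventuallyEq {f : N → X} {x₀ : X} {p : N}
    (hp : f p ∈ (chartAt E x₀).source) (hf : ContinuousAt f p)
    (V : ∀ q : N, TangentSpace 𝓘(ℝ, E) (f q)) :
    (fun q : N ↦ (trivializationAt E (TangentSpace 𝓘(ℝ, E) : X → Type _) x₀
        (⟨f q, V q⟩ : TangentBundle 𝓘(ℝ, E) X)).2) =ᶠ[𝓝 p] vecRep x₀ f V := by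
  filter_upwards [hf.preimage_mem_nhds ((chartAt E x₀).open_source.mem_nhds hp)] with q hq
  exact trivializationAt_snd hq _

variable [FiniteDimensional ℝ E]
  [RiemannianBundle (fun x : X ↦ TangentSpace 𝓘(ℝ, E) x)]

/-- The coordinate formula for the covariant derivative, with `fderiv` in place of `mfderiv`. -/
lemma covDeriv_eq {f : N → X} {p : N} (hf : ContinuousAt f p)
    (V : ∀ q : N, TangentSpace 𝓘(ℝ, E) (f q)) (v : N) :
    covDeriv f V p v = ofCoord (f p) (f p) (fderiv ℝ (vecRep (f p) f V) p v)
      + christoffel (f p) (differential f p v) (V p) := by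
  have h := vecRep_eventuallyEq (mem_chart_source E (f p)) hf V
  rw [← h.fderiv_eq, ← trivializationAt_symm (mem_chart_source E (f p))]
  rw [← mfderiv_eq_fderiv]
  rfl

variable (E) in
/-- The matrix `gᵢⱼ` of the metric at `q` in the preferred chart at `x₀`, as a bilinear form. -/
def chartMetric (x₀ q : X) : E →L[ℝ] E →L[ℝ] ℝ :=
  (innerSL ℝ (E := TangentSpace 𝓘(ℝ, E) q)).bilinearComp (ofCoord x₀ q) (ofCoord x₀ q)

lemma chartMetric_apply (x₀ q : X) (u v : E) :
    chartMetric E x₀ q u v = inner ℝ (ofCoord x₀ q u) (ofCoord x₀ q v) := rfl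

lemma inner_eq_chartMetric {x₀ q : X} (hq : q ∈ (chartAt E x₀).source)
    (u v : TangentSpace 𝓘(ℝ, E) q) :
    inner ℝ u v = chartMetric E x₀ q (toCoord x₀ q u) (toCoord x₀ q v) := by
  rw [chartMetric_apply, ofCoord_toCoord hq, ofCoord_toCoord hq]

end Along

/-! ### Metric compatibility of the Levi-Civita connection -/

section FiniteDimensional

/-- A family of linear maps on a finite-dimensional space is smooth if it is pointwise smooth. -/
lemma contDiffAt_clm {N G E : Type*} [NormedAddCommGroup N] [NormedSpace ℝ N]
    [NormedAddCommGroup G] [NormedSpace ℝ G]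
    [NormedAddCommGroup E] [NormedSpace ℝ E] [FiniteDimensional ℝ E] {n : ℕ∞ω}
    {g : N → E →L[ℝ] G} {p : N} (h : ∀ u, ContDiffAt ℝ n (fun q ↦ g q u) p) :
    ContDiffAt ℝ n g p := by
  let d := Module.finrank ℝ E
  have hd : d = Module.finrank ℝ (Fin d → ℝ) := (Module.finrank_fin_fun ℝ).symm
  let e₁ := ContinuousLinearEquiv.ofFinrankEq hd
  let e₂ := (e₁.arrowCongr (1 : G ≃L[ℝ] G)).trans (ContinuousLinearEquiv.piRing (Fin d))
  rw [← Function.id_comp g, ← e₂.symm_comp_self]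
  exact e₂.symm.contDiff.contDiffAt.comp p (contDiffAt_pi.mpr fun i ↦ h _)

end FiniteDimensional

section Metric

variable {E : Type*} [NormedAddCommGroup E] [NormedSpace ℝ E] [FiniteDimensional ℝ E]
  {X : Type*} [TopologicalSpace X] [ChartedSpace E X] [IsManifold 𝓘(ℝ, E) ∞ X]
  {N : Type*} [NormedAddCommGroup N] [NormedSpace ℝ N]

lemma contMDiffOn_ofCoord (x₀ : X) (v : E) :
    ContMDiffOn 𝓘(ℝ, E) 𝓘(ℝ, E).tangent ∞
      (fun q ↦ (⟨q, ofCoord x₀ q v⟩ : TangentBundle 𝓘(ℝ, E) X)) (chartAt E x₀).source := by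
  have h := Trivialization.contMDiffOn_symm (n := ∞) (IB := 𝓘(ℝ, E))
    (trivializationAt E (TangentSpace 𝓘(ℝ, E) : X → Type _) x₀)
  have h2 : ContMDiffOn 𝓘(ℝ, E) (𝓘(ℝ, E).prod 𝓘(ℝ, E)) ∞ (fun q : X ↦ (q, v))
    (chartAt E x₀).source := contMDiffOn_id.prodMk contMDiffOn_const
  refine (h.comp h2 ?_).congr ?_
  · intro q hq
    exact (trivializationAt E (TangentSpace 𝓘(ℝ, E) : X → Type _) x₀).mem_target.2 hq
  · intro q hq
    rw [← trivializationAt_symm hq]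
    exact (trivializationAt E (TangentSpace 𝓘(ℝ, E) : X → Type _) x₀).mk_symm hq v

-- Shortcut instances for the space of bilinear forms, in which metrics take their values.
instance bilinNormedAddCommGroup : NormedAddCommGroup (E →L[ℝ] E →L[ℝ] ℝ) :=
  ContinuousLinearMap.toNormedAddCommGroup
instance bilinAddCommGroup : AddCommGroup (E →L[ℝ] E →L[ℝ] ℝ) :=
  ContinuousLinearMap.addCommGroup
instance bilinNormedSpace : NormedSpace ℝ (E →L[ℝ] E →L[ℝ] ℝ) :=
  ContinuousLinearMap.toNormedSpace

variable [RiemannianBundle (fun x : X ↦ TangentSpace 𝓘(ℝ, E) x)]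
  [IsContMDiffRiemannianBundle 𝓘(ℝ, E) ∞ E (fun x : X ↦ TangentSpace 𝓘(ℝ, E) x)]

lemma contMDiffOn_chartMetric_apply (x₀ : X) (u v : E) :
    ContMDiffOn 𝓘(ℝ, E) 𝓘(ℝ, ℝ) ∞ (fun q ↦ chartMetric E x₀ q u v) (chartAt E x₀).source :=
  ContMDiffOn.inner_bundle (n := ∞) (IB := 𝓘(ℝ, E)) (F := E) (b := fun q : X ↦ q)
    (E := fun x : X ↦ TangentSpace 𝓘(ℝ, E) x) (contMDiffOn_ofCoord x₀ u) (contMDiffOn_ofCoord x₀ v)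

lemma contDiffAt_chartMetric_comp {x₀ : X} {f : N → X} {p : N}
    (hp : f p ∈ (chartAt E x₀).source) (hf : ContMDiffAt 𝓘(ℝ, N) 𝓘(ℝ, E) ∞ f p) :
    ContDiffAt ℝ ∞ (fun q ↦ (chartMetric E x₀ (f q) : E →L[ℝ] E →L[ℝ] ℝ)) p := by
  refine contDiffAt_clm fun u ↦ contDiffAt_clm fun v ↦ ?_
  have h := (contMDiffOn_chartMetric_apply x₀ u v).contMDiffAt
    ((chartAt E x₀).open_source.mem_nhds hp)
  exact (h.comp p hf).contDiffAt

lemma contDiffAt_chartMetric_symm {x₀ q : X} (hq : q ∈ (chartAt E x₀).source) :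
    ContDiffAt ℝ ∞
      (fun y ↦ (chartMetric E x₀ ((extChartAt 𝓘(ℝ, E) x₀).symm y) : E →L[ℝ] E →L[ℝ] ℝ))
      (extChartAt 𝓘(ℝ, E) x₀ q) := by
  have hq' : q ∈ (extChartAt 𝓘(ℝ, E) x₀).source := by simpa using hq
  apply contDiffAt_chartMetric_comp
  · rwa [(extChartAt 𝓘(ℝ, E) x₀).left_inv hq']
  · exact (contMDiffOn_extChartAt_symm x₀).contMDiffAt
      ((isOpen_extChartAt_target x₀).mem_nhds ((extChartAt 𝓘(ℝ, E) x₀).map_source hq'))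

variable (E) in
/-- The derivatives `∂ᵢ gⱼₖ` at `x` of the metric in the preferred chart at `x`, the derivative
being taken in the first argument. -/
def chartMetricFDeriv (x : X) : E →L[ℝ] E →L[ℝ] E →L[ℝ] ℝ :=
  fderiv ℝ (fun y ↦ chartMetric E x ((extChartAt 𝓘(ℝ, E) x).symm y)) (extChartAt 𝓘(ℝ, E) x x)

lemma hasFDerivAt_chartMetric_comp {f : N → X} {p : N}
    (hf : MDifferentiableAt 𝓘(ℝ, N) 𝓘(ℝ, E) f p) :
    HasFDerivAt (fun q ↦ (chartMetric E (f p) (f q) : E →L[ℝ] E →L[ℝ] ℝ))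
      ((chartMetricFDeriv E (f p)).comp (fderiv ℝ (extChartAt 𝓘(ℝ, E) (f p) ∘ f) p)) p := by
  have h1 := (contDiffAt_chartMetric_symm (mem_chart_source E (f p))).differentiableAt
    (by simp) |>.hasFDerivAt
  have h2 := (differentiableAt_extChartAt_comp (mem_chart_source E (f p)) hf).hasFDerivAt
  refine (HasFDerivAt.comp p h1 h2).congr_of_eventuallyEq ?_
  filter_upwards [hf.continuousAt.preimage_mem_nhds
    (extChartAt_source_mem_nhds (I := 𝓘(ℝ, E)) (f p))] with q hq
  simp only [Function.comp_apply]
  rw [(extChartAt 𝓘(ℝ, E) (f p)).left_inv hq]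

lemma metricDeriv_eq (x : X) (u v w : TangentSpace 𝓘(ℝ, E) x) :
    metricDeriv x u v w
      = chartMetricFDeriv E x (toCoord x x u) (toCoord x x v) (toCoord x x w) := by
  have hx := mem_chart_source E x
  set v' := toCoord x x v with hv'
  set w' := toCoord x x w with hw'
  have h1 := (contDiffAt_chartMetric_symm hx).differentiableAt (by simp)
  have h2 := (h1.hasFDerivAt.clm_apply (hasFDerivAt_const v' _)).clm_apply (hasFDerivAt_const w' _)
  have h3 : (fun q : X ↦ inner ℝ
      (FiberBundle.extend E v q : TangentSpace 𝓘(ℝ, E) q)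
      (FiberBundle.extend E w q : TangentSpace 𝓘(ℝ, E) q)) =ᶠ[𝓝 x]
      (fun y ↦ chartMetric E x ((extChartAt 𝓘(ℝ, E) x).symm y) v' w') ∘ extChartAt 𝓘(ℝ, E) x := by
    filter_upwards [extChartAt_source_mem_nhds (I := 𝓘(ℝ, E)) x] with q hq
    have hq' : q ∈ (chartAt E x).source := by simpa using hq
    simp only [Function.comp_apply]
    rw [(extChartAt 𝓘(ℝ, E) x).left_inv hq, chartMetric_apply]
    simp only [FiberBundle.extend, trivializationAt_symm hq']
    rw [trivializationAt_snd hx, trivializationAt_snd hx]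
  rw [metricDeriv, mvfderiv, h3.mfderiv_eq]
  have h4 := mfderiv_comp_apply x h2.differentiableAt.mdifferentiableAt
    (mdifferentiableAt_extChartAt hx) u
  rw [← toCoord_eq_mfderiv hx, mfderiv_eq_fderiv] at h4
  refine h4.trans ?_
  rw [h2.fderiv]
  simp only [ContinuousLinearMap.comp_zero, zero_add]
  rfl

lemma chartMetric_symm (x₀ q : X) (u v : E) : chartMetric E x₀ q u v = chartMetric E x₀ q v u :=
  real_inner_comm (ofCoord x₀ q v) (ofCoord x₀ q u)

lemma chartMetricFDeriv_symm (x : X) (u v w : E) :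
    chartMetricFDeriv E x u v w = chartMetricFDeriv E x u w v := by
  have h1 := (contDiffAt_chartMetric_symm (mem_chart_source E x)).differentiableAt (by simp)
  have h (v w : E) := ((h1.hasFDerivAt.clm_apply (hasFDerivAt_const v _)).clm_apply
    (hasFDerivAt_const w _))
  have h2 := (h v w).congr_of_eventuallyEq
    (.of_forall fun y ↦ chartMetric_symm x ((extChartAt 𝓘(ℝ, E) x).symm y) w v)
  have := congrArg (fun L => L u) (h2.unique (h w v))
  simpa [chartMetricFDeriv] using this

/-- Koszul's formula for the Christoffel symbol: the expansion in an orthonormal basis that defines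
it is that of the vector representing the linear form on the right. -/
lemma inner_christoffel (x : X) (u v w : TangentSpace 𝓘(ℝ, E) x) :
    inner ℝ (christoffel x u v) w =
      (chartMetricFDeriv E x (toCoord x x u) (toCoord x x v) (toCoord x x w)
      + chartMetricFDeriv E x (toCoord x x v) (toCoord x x u) (toCoord x x w)
      - chartMetricFDeriv E x (toCoord x x w) (toCoord x x u) (toCoord x x v)) / 2 := by
  set b := stdOrthonormalBasis ℝ (TangentSpace 𝓘(ℝ, E) x)
  let L : TangentSpace 𝓘(ℝ, E) x →ₗ[ℝ] ℝ :=
    { toFun := fun w ↦ (chartMetricFDeriv E x (toCoord x x u) (toCoord x x v) (toCoord x x w)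
        + chartMetricFDeriv E x (toCoord x x v) (toCoord x x u) (toCoord x x w)
        - chartMetricFDeriv E x (toCoord x x w) (toCoord x x u) (toCoord x x v)) / 2
      map_add' := fun a c ↦ by
        simp only [map_add, add_apply]; ring
      map_smul' := fun r a ↦ by
        simp only [map_smul, smul_apply, RingHom.id_apply, smul_eq_mul]
        ring }
  change _ = L w
  conv_rhs => rw [← b.sum_repr w, map_sum]
  rw [christoffel, sum_inner]
  refine Finset.sum_congr rfl fun i _ ↦ ?_
  rw [inner_smul_left, map_smul, b.repr_apply_apply, smul_eq_mul, mul_comm]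
  simp only [metricDeriv_eq, conj_trivial]
  rfl

lemma christoffel_symm (x : X) (u v : TangentSpace 𝓘(ℝ, E) x) :
    christoffel x u v = christoffel x v u := by
  refine ext_inner_right ℝ fun w ↦ ?_
  rw [inner_christoffel, inner_christoffel,
    chartMetricFDeriv_symm x (toCoord x x w) (toCoord x x u) (toCoord x x v)]
  ring

/-- Metric compatibility of the Levi-Civita connection, for vector fields along a map: the product
rule `v⟨V, W⟩ = ⟨∇ᵥV, W⟩ + ⟨V, ∇ᵥW⟩`. -/
theorem fderiv_inner_eq_covDeriv {f : N → X} {p : N}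
    (hf : MDifferentiableAt 𝓘(ℝ, N) 𝓘(ℝ, E) f p)
    {V W : ∀ q : N, TangentSpace 𝓘(ℝ, E) (f q)}
    (hV : DifferentiableAt ℝ (vecRep (f p) f V) p) (hW : DifferentiableAt ℝ (vecRep (f p) f W) p) :
    DifferentiableAt ℝ (fun q ↦ inner ℝ (V q) (W q)) p ∧ ∀ v,
    fderiv ℝ (fun q ↦ inner ℝ (V q) (W q)) p v
      = inner ℝ (covDeriv f V p v) (W p) + inner ℝ (V p) (covDeriv f W p v) := by
  have hp := mem_chart_source E (f p)
  have h1 : (fun q ↦ inner ℝ (V q) (W q)) =ᶠ[𝓝 p]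
      fun q ↦ chartMetric E (f p) (f q) (vecRep (f p) f V q) (vecRep (f p) f W q) := by
    filter_upwards [hf.continuousAt.preimage_mem_nhds ((chartAt E (f p)).open_source.mem_nhds hp)]
      with q hq
    exact inner_eq_chartMetric hq _ _
  have h2 := ((hasFDerivAt_chartMetric_comp hf).clm_apply hV.hasFDerivAt).clm_apply
    hW.hasFDerivAt
  have h3 := h2.congr_of_eventuallyEq h1
  refine ⟨h3.differentiableAt, fun v ↦ ?_⟩
  rw [h3.fderiv, covDeriv_eq hf.continuousAt, covDeriv_eq hf.continuousAt, inner_add_left,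
    inner_add_right, inner_christoffel, real_inner_comm (christoffel _ _ _), inner_christoffel]
  rw [inner_eq_chartMetric hp _ (W p), inner_eq_chartMetric hp (V p), toCoord_ofCoord hp,
    toCoord_ofCoord hp]
  simp only [add_apply, ContinuousLinearMap.comp_apply,
    ContinuousLinearMap.flip_apply, fderiv_extChartAt_comp hp hf, vecRep]
  set a : E := toCoord (f p) (f p) (V p)
  set c : E := toCoord (f p) (f p) (W p)
  set d : E := toCoord (f p) (f p) (differential f p v)
  have s1 := chartMetricFDeriv_symm (f p) a c d
  have s2 := chartMetricFDeriv_symm (f p) c a d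
  have s3 := chartMetricFDeriv_symm (f p) d a c
  linarith

end Metric

/-! ### The Hessian of a parametrization -/

section Hessian

variable {E : Type*} [NormedAddCommGroup E] [NormedSpace ℝ E] [FiniteDimensional ℝ E]
  {X : Type*} [TopologicalSpace X] [ChartedSpace E X] [IsManifold 𝓘(ℝ, E) ∞ X]
  {N : Type*} [NormedAddCommGroup N] [NormedSpace ℝ N]
  {N' : Type*} [NormedAddCommGroup N'] [NormedSpace ℝ N']

lemma contDiffAt_extChartAt_comp {f : N → X} {x₀ : X} {p : N}
    (hp : f p ∈ (chartAt E x₀).source) (hf : ContMDiffAt 𝓘(ℝ, N) 𝓘(ℝ, E) ∞ f p) :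
    ContDiffAt ℝ ∞ (extChartAt 𝓘(ℝ, E) x₀ ∘ f) p :=
  ((contMDiffAt_extChartAt' hp).comp p hf).contDiffAt

lemma vecRep_differential_eventuallyEq {U : Set N} (hU : IsOpen U) {Φ : N → X}
    (hΦ : ContMDiffOn 𝓘(ℝ, N) 𝓘(ℝ, E) ∞ Φ U) {y : N} (hy : y ∈ U) {x₀ : X}
    (hx : Φ y ∈ (chartAt E x₀).source) :
    ∀ᶠ z in 𝓝 y, ∀ v, toCoord x₀ (Φ z) (differential Φ z v)
      = fderiv ℝ (extChartAt 𝓘(ℝ, E) x₀ ∘ Φ) z v := by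
  have hc : ContinuousAt Φ y := (hΦ.contMDiffAt (hU.mem_nhds hy)).continuousAt
  filter_upwards [hU.mem_nhds hy,
    hc.preimage_mem_nhds ((chartAt E x₀).open_source.mem_nhds hx)] with z hz hz' v
  exact (fderiv_extChartAt_comp hz'
    ((hΦ.contMDiffAt (hU.mem_nhds hz)).mdifferentiableAt (by simp)) v).symm

lemma differential_comp {Φ : N → X} {c : N' → N} {s : N'}
    (hΦ : MDifferentiableAt 𝓘(ℝ, N) 𝓘(ℝ, E) Φ (c s)) (hc : DifferentiableAt ℝ c s) (v : N') :
    differential (E := E) (Φ ∘ c) s v = differential Φ (c s) (fderiv ℝ c s v) := by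
  have h := mfderiv_comp_apply s hΦ hc.mdifferentiableAt v
  rw [mfderiv_eq_fderiv] at h
  exact h

variable [RiemannianBundle (fun x : X ↦ TangentSpace 𝓘(ℝ, E) x)]

/-- The Hessian `∇ᵤ(dΦ(v))` of a map `Φ` from a vector space into a Riemannian manifold, where `v`
is a constant vector field. The normal part of the Hessian of a parametrization of a submanifold is
the second fundamental form. -/
def hess (Φ : N → X) (y u v : N) : TangentSpace 𝓘(ℝ, E) (Φ y) :=
  covDeriv Φ (fun z ↦ differential Φ z v) y u

section
variable {U : Set N} (hU : IsOpen U) {Φ : N → X}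
    (hΦ : ContMDiffOn 𝓘(ℝ, N) 𝓘(ℝ, E) ∞ Φ U)
include hU hΦ

lemma hasFDerivAt_vecRep_differential {c : N' → N} {s : N'} (hs : c s ∈ U)
    (hc : DifferentiableAt ℝ c s) {V : N' → N} (hV : DifferentiableAt ℝ V s) {x₀ : X}
    (hx : Φ (c s) ∈ (chartAt E x₀).source) :
    HasFDerivAt (vecRep x₀ (Φ ∘ c) (fun t ↦ differential Φ (c t) (V t)))
      (((fderiv ℝ (extChartAt 𝓘(ℝ, E) x₀ ∘ Φ) (c s))).comp (fderiv ℝ V s) +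
        ((fderiv ℝ (fderiv ℝ (extChartAt 𝓘(ℝ, E) x₀ ∘ Φ)) (c s)).comp
          (fderiv ℝ c s)).flip (V s)) s := by
  have h0 := contDiffAt_extChartAt_comp hx (hΦ.contMDiffAt (hU.mem_nhds hs))
  have h1 : DifferentiableAt ℝ (fderiv ℝ (extChartAt 𝓘(ℝ, E) x₀ ∘ Φ)) (c s) :=
    (h0.fderiv_right (m := ∞) (by simp)).differentiableAt (by simp)
  have h2 := (h1.hasFDerivAt.comp s hc.hasFDerivAt).clm_apply hV.hasFDerivAt
  refine h2.congr_of_eventuallyEq ?_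
  filter_upwards [hc.continuousAt.eventually
    (vecRep_differential_eventuallyEq hU hΦ hs hx)] with t ht
  exact ht _

/-- The covariant derivative along `Φ ∘ c` of the field `dΦ(V)`, for a vector field `V` along `c` in
the parameter space. -/
theorem covDeriv_differential_comp {c : N' → N} {s : N'} (hs : c s ∈ U)
    (hc : DifferentiableAt ℝ c s) {V : N' → N} (hV : DifferentiableAt ℝ V s) (v : N') :
    covDeriv (E := E) (Φ ∘ c) (fun t ↦ differential Φ (c t) (V t)) s v =
      hess Φ (c s) (fderiv ℝ c s v) (V s) + differential Φ (c s) (fderiv ℝ V s v) := by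
  have hd := (hΦ.contMDiffAt (hU.mem_nhds hs))
  have hx := mem_chart_source E (Φ (c s))
  have h1 := hasFDerivAt_vecRep_differential hU hΦ hs hc hV hx
  have h2 := hasFDerivAt_vecRep_differential hU hΦ (c := id) (s := c s) hs differentiableAt_id
    (V := fun _ ↦ V s) (differentiableAt_const _) hx
  rw [covDeriv_eq (f := Φ ∘ c) (ContinuousAt.comp hd.continuousAt hc.continuousAt), hess,
    covDeriv_eq hd.continuousAt]
  simp only [Function.comp_id] at h2
  have h3 := congrArg (fun L ↦ L v) h1.fderiv
  have h4 := congrArg (fun L ↦ L (fderiv ℝ c s v)) h2.fderiv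
  simp only [id_eq] at h4
  simp only [Function.comp_apply] at h3 ⊢
  rw [h3, h4, differential_comp (hd.mdifferentiableAt (by simp)) hc]
  have h5 : ofCoord (Φ (c s)) (Φ (c s)) ((fderiv ℝ (extChartAt 𝓘(ℝ, E) (Φ (c s)) ∘ Φ) (c s))
      (fderiv ℝ V s v)) = differential Φ (c s) (fderiv ℝ V s v) := by
    rw [fderiv_extChartAt_comp hx (hd.mdifferentiableAt (by simp)), ofCoord_toCoord hx]
  rw [← h5]
  simp
  abel

variable [FiniteDimensional ℝ N]

/-- The Hessian in the preferred chart at `Φ y`: `∂ᵤ∂ᵥΦᵏ + Γᵏᵢⱼ ∂ᵤΦⁱ ∂ᵥΦʲ`. -/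
lemma hess_eq {y : N} (hy : y ∈ U) (u v : N) :
    hess Φ y u v = ofCoord (Φ y) (Φ y)
      (fderiv ℝ (fderiv ℝ (extChartAt 𝓘(ℝ, E) (Φ y) ∘ Φ)) y u v) +
      christoffel (Φ y) (differential Φ y u) (differential Φ y v) := by
  have hd := (hΦ.contMDiffAt (hU.mem_nhds hy))
  have h2 := hasFDerivAt_vecRep_differential hU hΦ (c := id) (s := y) hy differentiableAt_id
    (V := fun _ ↦ v) (differentiableAt_const _) (mem_chart_source E (Φ y))
  rw [hess, covDeriv_eq hd.continuousAt]
  have h4 := congrArg (fun L ↦ L u) h2.fderiv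
  simp only [Function.comp_id, id_eq] at h4
  rw [h4]
  simp

end

end Hessian

/-! ### The pulled-back metric and Koszul's formula -/

section VectorSpace

variable {N : Type*} [NormedAddCommGroup N] [NormedSpace ℝ N]

/-- The right-hand side of Koszul's formula for commuting vector fields, as a linear form in the
last vector; `T u v w` stands for the derivative of `⟨v, w⟩` in the direction `u`. -/
def koszulForm (T : N →L[ℝ] N →L[ℝ] N →L[ℝ] ℝ) (u v : N) : N →L[ℝ] ℝ :=
  (1 / 2 : ℝ) • (T u v + T v u - (T.flip u).flip v)

lemma koszulForm_apply (T : N →L[ℝ] N →L[ℝ] N →L[ℝ] ℝ) (u v w : N) :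
    koszulForm T u v w = (T u v w + T v u w - T w u v) / 2 := by
  simp [koszulForm]; ring

/-- The Christoffel symbols of a metric `G` on a vector space, with `G` viewed as a map to the dual;
a junk value where `G y` is degenerate. -/
def metricChristoffel (G : N → N →L[ℝ] N →L[ℝ] ℝ) (y u v : N) : N :=
  (G y).inverse (koszulForm (fderiv ℝ G y) u v)

variable [FiniteDimensional ℝ N]

lemma isInvertible_of_pos {B : N →L[ℝ] N →L[ℝ] ℝ} (hB : ∀ u, u ≠ 0 → 0 < B u u) :
    B.IsInvertible := by
  have hinj : Function.Injective (B : N →ₗ[ℝ] N →L[ℝ] ℝ) := by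
    rw [injective_iff_map_eq_zero]
    intro u hu
    by_contra h
    have := hB u h
    rw [show B u = 0 from hu] at this
    simp at this
  have hfr : Module.finrank ℝ N = Module.finrank ℝ (N →L[ℝ] ℝ) := by
    rw [← (LinearMap.toContinuousLinearMap (𝕜 := ℝ) (E := N) (F' := ℝ)).finrank_eq]
    exact (Subspace.dual_finrank_eq (K := ℝ) (V := N)).symm
  let e := (LinearEquiv.ofInjectiveOfFinrankEq _ hinj hfr).toContinuousLinearEquiv
  exact ⟨e, by ext; rfl⟩

lemma apply_inverse_of_isInvertible {B : N →L[ℝ] N →L[ℝ] ℝ} (hB : B.IsInvertible) (l : N →L[ℝ] ℝ) :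
    B (B.inverse l) = l := by
  obtain ⟨e, rfl⟩ := hB
  simp

lemma contDiffAt_inverse {P : Type*} [NormedAddCommGroup P] [NormedSpace ℝ P] {n : ℕ∞ω}
    {G : P → N →L[ℝ] N →L[ℝ] ℝ} {y : P}
    (hG : ContDiffAt ℝ n G y) (hy : (G y).IsInvertible) :
    ContDiffAt ℝ n (fun z ↦ (G z).inverse) y := by
  obtain ⟨e, he⟩ := hy
  have := contDiffAt_map_inverse (n := n) e
  rw [he] at this
  exact this.comp y hG

lemma contDiffAt_metricChristoffel {P : Type*} [NormedAddCommGroup P] [NormedSpace ℝ P]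
    {G : N → N →L[ℝ] N →L[ℝ] ℝ} {y u v : P → N} {p : P}
    (hG : ContDiffAt ℝ ∞ G (y p)) (hy : (G (y p)).IsInvertible)
    (hy' : ContDiffAt ℝ ∞ y p) (hu : ContDiffAt ℝ ∞ u p) (hv : ContDiffAt ℝ ∞ v p) :
    ContDiffAt ℝ ∞ (fun q ↦ metricChristoffel G (y q) (u q) (v q)) p := by
  have h1 : ContDiffAt ℝ ∞ (fun q ↦ (G (y q)).inverse) p :=
    contDiffAt_inverse (hG.comp p hy') hy
  refine h1.clm_apply (contDiffAt_clm fun w ↦ ?_)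
  simp only [koszulForm_apply]
  have h2 : ContDiffAt ℝ ∞ (fun q ↦ fderiv ℝ G (y q)) p :=
    (hG.fderiv_right (m := ∞) (by simp)).comp p hy'
  have hw : ContDiffAt ℝ ∞ (fun _ : P ↦ w) p := contDiffAt_const
  exact ((((h2.clm_apply hu).clm_apply hv).clm_apply hw).add
    (((h2.clm_apply hv).clm_apply hu).clm_apply hw)).sub
    (((h2.clm_apply hw).clm_apply hu).clm_apply hv) |>.div_const 2

end VectorSpace

section Gram

variable {E : Type*} [NormedAddCommGroup E] [NormedSpace ℝ E] [FiniteDimensional ℝ E]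
  {X : Type*} [TopologicalSpace X] [ChartedSpace E X] [IsManifold 𝓘(ℝ, E) ∞ X]
  {N : Type*} [NormedAddCommGroup N] [NormedSpace ℝ N] [FiniteDimensional ℝ N]
  [RiemannianBundle (fun x : X ↦ TangentSpace 𝓘(ℝ, E) x)]

variable (E) in
/-- The pull-back by `Φ` of the Riemannian metric, as a bilinear form on the parameter space. -/
def gram (Φ : N → X) (y : N) : N →L[ℝ] N →L[ℝ] ℝ :=
  (innerSL ℝ (E := TangentSpace 𝓘(ℝ, E) (Φ y))).bilinearComp (differential Φ y) (differential Φ y)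

lemma gram_apply (Φ : N → X) (y u v : N) :
    gram E Φ y u v = inner ℝ (differential (E := E) Φ y u) (differential Φ y v) := rfl

lemma isInvertible_gram {Φ : N → X} {y : N}
    (h : Function.Injective (differential (E := E) Φ y)) : (gram E Φ y).IsInvertible := by
  refine isInvertible_of_pos fun u hu ↦ ?_
  rw [gram_apply, real_inner_self_eq_norm_sq]
  have : differential (E := E) Φ y u ≠ 0 := fun h0 ↦ hu (h (by rw [h0, map_zero]))
  positivity

variable [IsContMDiffRiemannianBundle 𝓘(ℝ, E) ∞ E (fun x : X ↦ TangentSpace 𝓘(ℝ, E) x)]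
  {U : Set N} (hU : IsOpen U) {Φ : N → X} (hΦ : ContMDiffOn 𝓘(ℝ, N) 𝓘(ℝ, E) ∞ Φ U)
include hU hΦ

lemma differentiableAt_vecRep_differential {y : N} (hy : y ∈ U) {V : N → N}
    (hV : DifferentiableAt ℝ V y) {x₀ : X}
    (hx : Φ y ∈ (chartAt E x₀).source) :
    DifferentiableAt ℝ (vecRep (E := E) x₀ Φ (fun z ↦ differential Φ z (V z))) y :=
  (hasFDerivAt_vecRep_differential hU hΦ (c := id) (s := y) hy differentiableAt_id
    hV hx).differentiableAt

lemma contDiffAt_gram {y : N} (hy : y ∈ U) : ContDiffAt ℝ ∞ (gram E Φ) y := by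
  have hd := (hΦ.contMDiffAt (hU.mem_nhds hy))
  have hx := mem_chart_source E (Φ y)
  refine contDiffAt_clm fun u ↦ contDiffAt_clm fun v ↦ ?_
  have h1 := contDiffAt_chartMetric_comp hx hd
  have h2 := contDiffAt_extChartAt_comp hx hd
  have h3 : ContDiffAt ℝ ∞ (fderiv ℝ (extChartAt 𝓘(ℝ, E) (Φ y) ∘ Φ)) y :=
    h2.fderiv_right (m := ∞) (by simp)
  have h4 := (h1.clm_apply (h3.clm_apply (contDiffAt_const (c := u)))).clm_apply
    (h3.clm_apply (contDiffAt_const (c := v)))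
  refine h4.congr_of_eventuallyEq ?_
  filter_upwards [vecRep_differential_eventuallyEq hU hΦ hy hx,
    hd.continuousAt.preimage_mem_nhds ((chartAt E (Φ y)).open_source.mem_nhds hx)] with z hz hz'
  rw [gram_apply, inner_eq_chartMetric hz', hz, hz]

/-- The Hessian is symmetric because the Levi-Civita connection is torsion-free. -/
lemma hess_symm {y : N} (hy : y ∈ U) (u v : N) :
    hess (E := E) Φ y u v = hess Φ y v u := by
  rw [hess_eq hU hΦ hy, hess_eq hU hΦ hy, christoffel_symm]
  have h := contDiffAt_extChartAt_comp (mem_chart_source E (Φ y))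
    (hΦ.contMDiffAt (hU.mem_nhds hy))
  have := h.isSymmSndFDerivAt (by
    rw [minSmoothness_of_isRCLikeNormedField]
    exact WithTop.coe_le_coe.2 le_top)
  rw [this u v]

lemma fderiv_gram {y : N} (hy : y ∈ U) (u v w : N) :
    fderiv ℝ (gram E Φ) y u v w = inner ℝ (hess (E := E) Φ y u v) (differential Φ y w)
      + inner ℝ (differential (E := E) Φ y v) (hess Φ y u w) := by
  have hd := (hΦ.contMDiffAt (hU.mem_nhds hy)).mdifferentiableAt (by simp)
  have hx := mem_chart_source E (Φ y)
  have h1 := (contDiffAt_gram hU hΦ hy).differentiableAt (by simp)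
  have h2 := (h1.hasFDerivAt.clm_apply (hasFDerivAt_const v y)).clm_apply (hasFDerivAt_const w y)
  have h3 := (fderiv_inner_eq_covDeriv hd
    (differentiableAt_vecRep_differential hU hΦ hy (differentiableAt_const v) hx)
    (differentiableAt_vecRep_differential hU hΦ hy (differentiableAt_const w) hx)).2 u
  refine Eq.trans ?_ h3
  have h4 := congrArg (fun L ↦ L u) h2.fderiv
  simp only [gram_apply] at h4
  rw [h4]
  simp only [ContinuousLinearMap.comp_zero, zero_add]
  rfl

/-- Koszul's formula: the tangential part of the Hessian is determined by the pulled-back metric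
alone. -/
theorem inner_hess_differential {y : N} (hy : y ∈ U) (u v w : N) :
    inner ℝ (hess (E := E) Φ y u v) (differential Φ y w) =
      koszulForm (fderiv ℝ (gram E Φ) y) u v w := by
  rw [koszulForm_apply, fderiv_gram hU hΦ hy, fderiv_gram hU hΦ hy, fderiv_gram hU hΦ hy,
    hess_symm hU hΦ hy v u, hess_symm hU hΦ hy w u, hess_symm hU hΦ hy w v,
    real_inner_comm (hess Φ y u w), real_inner_comm (hess Φ y v w)]
  ring

theorem inner_hess_eq_gram {y : N} (hy : y ∈ U)
    (hinj : Function.Injective (differential (E := E) Φ y)) (u v w : N) :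
    inner ℝ (hess (E := E) Φ y u v) (differential Φ y w) =
      gram E Φ y (metricChristoffel (gram E Φ) y u v) w := by
  rw [inner_hess_differential hU hΦ hy, metricChristoffel,
    apply_inverse_of_isInvertible (isInvertible_gram hinj)]

/-- In a parametrization of the whole manifold the Hessian is given by the Christoffel symbols of
the pulled-back metric. -/
theorem hess_eq_differential_metricChristoffel {y : N} (hy : y ∈ U)
    (hbij : Function.Bijective (differential (E := E) Φ y)) (u v : N) :
    hess (E := E) Φ y u v = differential Φ y (metricChristoffel (gram E Φ) y u v) := by
  refine ext_inner_right ℝ fun w ↦ ?_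
  obtain ⟨w, rfl⟩ := hbij.2 w
  rw [inner_hess_eq_gram hU hΦ hy hbij.1, gram_apply]

end Gram

/-! ### Integral curves and the geodesic equation -/

section ODE

/-- A smooth vector field has a smooth integral curve through each point. -/
lemma exists_smooth_integralCurve {P : Type*} [NormedAddCommGroup P] [NormedSpace ℝ P]
    [CompleteSpace P] {F : P → P} {W : Set P} (hW : IsOpen W) (hF : ContDiffOn ℝ ∞ F W) {x : P}
    (hx : x ∈ W) :
    ∃ ε > 0, ∃ a : ℝ → P, a 0 = x ∧ ContDiffOn ℝ ∞ a (Ioo (-ε) ε) ∧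
      ∀ t ∈ Ioo (-ε) ε, a t ∈ W ∧ HasDerivAt a (F (a t)) t := by
  obtain ⟨a, ha0, ε, hε, ha⟩ := ((hF.contDiffAt (hW.mem_nhds hx)).of_le
    (m := 1) (by exact_mod_cast le_top)
    ).exists_forall_mem_closedBall_exists_eq_forall_mem_Ioo_hasDerivAt₀ 0
  simp only [zero_sub, zero_add] at ha
  have hc : ContinuousAt a 0 := (ha 0 ⟨by linarith, hε⟩).continuousAt
  have h1 : a ⁻¹' W ∈ 𝓝 (0 : ℝ) := hc.preimage_mem_nhds (by rw [ha0]; exact hW.mem_nhds hx)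
  obtain ⟨δ, hδ, hδW⟩ := Metric.mem_nhds_iff.1 h1
  -- The curve is differentiable on `(-ε, ε)` and in `W` on `(-δ, δ)`; halving makes the closed
  -- interval `[-ρ, ρ]` lie in both.
  set ρ := min ε δ / 2 with hρ
  have hm : 0 < min ε δ := lt_min hε hδ
  have hρ0 : 0 < ρ := by positivity
  have hρε : ρ < ε := by have := min_le_left ε δ; linarith
  have hρδ : ρ < δ := by have := min_le_right ε δ; linarith
  have hmem : MapsTo a (Icc (-ρ) ρ) W := fun t ht ↦ hδW (by
    rw [Metric.mem_ball, dist_zero_right, Real.norm_eq_abs, abs_lt]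
    constructor <;> linarith [ht.1, ht.2])
  have hd : ∀ t ∈ Icc (-ρ) ρ, HasDerivAt a (F (a t)) t := fun t ht ↦
    ha t ⟨by linarith [ht.1], by linarith [ht.2]⟩
  refine ⟨ρ, hρ0, a, ha0, ?_, fun t ht ↦ ⟨hmem (Ioo_subset_Icc_self ht),
    hd t (Ioo_subset_Icc_self ht)⟩⟩
  have h2 : ContDiffOn ℝ ∞ (Function.uncurry fun _ : ℝ ↦ F) ((Icc (-ρ) ρ) ×ˢ W) :=
    hF.comp contDiff_snd.contDiffOn fun q hq ↦ hq.2
  exact (ODE.contDiffOn_enat_Icc_of_hasDerivWithinAt (n := ⊤) h2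
    (fun t ht ↦ (hd t ht).hasDerivWithinAt) hmem).mono Ioo_subset_Icc_self

/-- Geodesics of a metric on an open subset of a vector space, as integral curves of the geodesic
spray `(y, v) ↦ (v, -Γ_y(v, v))`. -/
lemma exists_metric_geodesic {N : Type*} [NormedAddCommGroup N] [NormedSpace ℝ N]
    [FiniteDimensional ℝ N] {U : Set N} (hU : IsOpen U) {G : N → N →L[ℝ] N →L[ℝ] ℝ}
    (hG : ∀ y ∈ U, ContDiffAt ℝ ∞ G y) (hinv : ∀ y ∈ U, (G y).IsInvertible)
    {y : N} (hy : y ∈ U) (v : N) :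
    ∃ ε > 0, ∃ c : ℝ → N, c 0 = y ∧ deriv c 0 = v ∧ ContDiffOn ℝ ∞ c (Ioo (-ε) ε) ∧
      ∀ t ∈ Ioo (-ε) ε, c t ∈ U ∧
        HasDerivAt (deriv c) (-metricChristoffel G (c t) (deriv c t) (deriv c t)) t := by
  have := FiniteDimensional.complete ℝ N
  obtain ⟨ε, hε, a, ha0, ha, had⟩ := exists_smooth_integralCurve (P := N × N)
    (F := fun q ↦ (q.2, -metricChristoffel G q.1 q.2 q.2)) (W := U ×ˢ univ) (x := (y, v))
    (hU.prod isOpen_univ) (fun q hq ↦ (contDiffAt_snd.prodMk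
      (contDiffAt_metricChristoffel (hG _ hq.1) (hinv _ hq.1) contDiffAt_fst contDiffAt_snd
        contDiffAt_snd).neg).contDiffWithinAt) ⟨hy, trivial⟩
  have h1 (t) (ht : t ∈ Ioo (-ε) ε) : HasDerivAt (fun t ↦ (a t).1) (a t).2 t :=
    (had t ht).2.fst
  have h2 (t) (ht : t ∈ Ioo (-ε) ε) : HasDerivAt (fun t ↦ (a t).2)
      (-metricChristoffel G (a t).1 (a t).2 (a t).2) t := (had t ht).2.snd
  have h3 (t) (ht : t ∈ Ioo (-ε) ε) : deriv (fun t ↦ (a t).1) t = (a t).2 := (h1 t ht).deriv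
  have h0 : (0 : ℝ) ∈ Ioo (-ε) ε := ⟨by linarith, hε⟩
  refine ⟨ε, hε, fun t ↦ (a t).1, congrArg Prod.fst ha0, by rw [h3 0 h0, ha0],
    contDiff_fst.comp_contDiffOn ha, fun t ht ↦ ⟨(had t ht).1.1, ?_⟩⟩
  rw [h3 t ht]
  refine (h2 t ht).congr_of_eventuallyEq ?_
  filter_upwards [isOpen_Ioo.mem_nhds ht] with s hs using h3 s hs

end ODE

section Curves

variable {E : Type*} [NormedAddCommGroup E] [NormedSpace ℝ E] [FiniteDimensional ℝ E]
  {X : Type*} [TopologicalSpace X] [ChartedSpace E X] [IsManifold 𝓘(ℝ, E) ∞ X]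
  {N : Type*} [NormedAddCommGroup N] [NormedSpace ℝ N] [FiniteDimensional ℝ N]
  [RiemannianBundle (fun x : X ↦ TangentSpace 𝓘(ℝ, E) x)]

lemma covDeriv_congr {F M : Type*} [NormedAddCommGroup F] [NormedSpace ℝ F] [TopologicalSpace M]
    [ChartedSpace F M]
    {f : M → X} {V W : ∀ q, TangentSpace 𝓘(ℝ, E) (f q)} {p : M}
    (h : ∀ᶠ q in 𝓝 p, V q = W q) (v : TangentSpace 𝓘(ℝ, F) p) :
    covDeriv f V p v = covDeriv f W p v := by
  have h1 : (fun q : M ↦ (trivializationAt E (TangentSpace 𝓘(ℝ, E) : X → Type _) (f p)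
      (⟨f q, V q⟩ : TangentBundle 𝓘(ℝ, E) X)).2) =ᶠ[𝓝 p]
      (fun q : M ↦ (trivializationAt E (TangentSpace 𝓘(ℝ, E) : X → Type _) (f p)
      (⟨f q, W q⟩ : TangentBundle 𝓘(ℝ, E) X)).2) := by
    filter_upwards [h] with q hq
    rw [hq]
  rw [covDeriv, covDeriv, mvfderiv, mvfderiv, h1.mfderiv_eq, h.self_of_nhds]

lemma velocity_comp {Φ : N → X} {c : ℝ → N} {t : ℝ}
    (hΦ : MDifferentiableAt 𝓘(ℝ, N) 𝓘(ℝ, E) Φ (c t)) (hc : DifferentiableAt ℝ c t) :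
    velocity (E := E) (Φ ∘ c) t = differential Φ (c t) (deriv c t) :=
  differential_comp hΦ hc 1

variable [IsContMDiffRiemannianBundle 𝓘(ℝ, E) ∞ E (fun x : X ↦ TangentSpace 𝓘(ℝ, E) x)]

section
variable {U : Set N} (hU : IsOpen U) {Φ : N → X} (hΦ : ContMDiffOn 𝓘(ℝ, N) 𝓘(ℝ, E) ∞ Φ U)
include hU hΦ

lemma covDerivCurve_differential {c : ℝ → N} {t : ℝ} (ht : c t ∈ U) (hc : DifferentiableAt ℝ c t)
    {V : ℝ → N} (hV : DifferentiableAt ℝ V t) :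
    covDerivCurve (E := E) (Φ ∘ c) (fun s ↦ differential Φ (c s) (V s)) t =
      hess Φ (c t) (deriv c t) (V t) + differential Φ (c t) (deriv V t) :=
  covDeriv_differential_comp hU hΦ ht hc hV 1

lemma covDerivCurve_velocity {c : ℝ → N} {J : Set ℝ} (hJ : IsOpen J) (hcJ : ContDiffOn ℝ ∞ c J)
    (hcU : MapsTo c J U) {t : ℝ} (ht : t ∈ J) :
    covDerivCurve (E := E) (Φ ∘ c) (velocity (Φ ∘ c)) t =
      hess Φ (c t) (deriv c t) (deriv c t) + differential Φ (c t) (deriv (deriv c) t) := by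
  have hd (s) (hs : s ∈ J) : DifferentiableAt ℝ c s :=
    (hcJ.contDiffAt (hJ.mem_nhds hs)).differentiableAt (by simp)
  have hdd : DifferentiableAt ℝ (deriv c) t :=
    ((hcJ.deriv_of_isOpen (m := ∞) hJ (by simp)).contDiffAt (hJ.mem_nhds ht)).differentiableAt
      (by simp)
  rw [← covDerivCurve_differential hU hΦ (hcU ht) (hd t ht) hdd]
  refine covDeriv_congr ?_ _
  filter_upwards [hJ.mem_nhds ht] with s hs
  exact velocity_comp ((hΦ.contMDiffAt (hU.mem_nhds (hcU hs))).mdifferentiableAt (by simp))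
    (hd s hs)

end

end Curves

/-! ### Existence of unit-speed geodesics -/

section Geodesic

variable {E : Type*} [NormedAddCommGroup E] [NormedSpace ℝ E] [FiniteDimensional ℝ E]
  {M : Type*} [TopologicalSpace M] [ChartedSpace E M] [IsManifold 𝓘(ℝ, E) ∞ M]

variable (E) in
/-- The parametrization of a neighbourhood of `x₀` by the inverse of the preferred chart, defined on
the target of the chart. -/
abbrev chartParam (x₀ : M) : E → M := (extChartAt 𝓘(ℝ, E) x₀).symm

lemma contMDiffOn_chartParam (x₀ : M) :
    ContMDiffOn 𝓘(ℝ, E) 𝓘(ℝ, E) ∞ (chartParam E x₀) (extChartAt 𝓘(ℝ, E) x₀).target :=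
  contMDiffOn_extChartAt_symm x₀

lemma chartParam_mem_source {x₀ : M} {y : E} (hy : y ∈ (extChartAt 𝓘(ℝ, E) x₀).target) :
    chartParam E x₀ y ∈ (chartAt E x₀).source := by
  have := (extChartAt 𝓘(ℝ, E) x₀).map_target hy
  rwa [extChartAt_source] at this

lemma differential_chartParam {x₀ : M} {y : E} (hy : y ∈ (extChartAt 𝓘(ℝ, E) x₀).target) (v : E) :
    differential (chartParam E x₀) y v = ofCoord x₀ (chartParam E x₀ y) v := by
  have h := TangentBundle.symmL_trivializationAt (I := 𝓘(ℝ, E)) (chartParam_mem_source hy)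
  rw [(extChartAt 𝓘(ℝ, E) x₀).right_inv hy] at h
  have h3 : Set.range 𝓘(ℝ, E) = Set.univ := by simp
  rw [h3, mfderivWithin_univ] at h
  exact (congrArg (fun L => L v) h).symm

lemma toCoord_differential_chartParam {x₀ : M} {y : E}
    (hy : y ∈ (extChartAt 𝓘(ℝ, E) x₀).target) (v : E) :
    toCoord x₀ (chartParam E x₀ y) (differential (chartParam E x₀) y v) = v := by
  rw [differential_chartParam hy, toCoord_ofCoord (chartParam_mem_source hy)]

lemma differential_chartParam_toCoord {x₀ : M} {y : E}
    (hy : y ∈ (extChartAt 𝓘(ℝ, E) x₀).target) (v : TangentSpace 𝓘(ℝ, E) (chartParam E x₀ y)) :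
    differential (chartParam E x₀) y (toCoord x₀ (chartParam E x₀ y) v) = v := by
  rw [differential_chartParam hy, ofCoord_toCoord (chartParam_mem_source hy)]

lemma bijective_differential_chartParam {x₀ : M} {y : E}
    (hy : y ∈ (extChartAt 𝓘(ℝ, E) x₀).target) :
    Function.Bijective (differential (E := E) (X := M) (chartParam E x₀) y) :=
  Function.bijective_iff_has_inverse.2 ⟨toCoord x₀ (chartParam E x₀ y),
    toCoord_differential_chartParam hy, differential_chartParam_toCoord hy⟩

lemma exists_chartParam_eq (p : M) :
    ∃ x₀ : M, ∃ y ∈ (extChartAt 𝓘(ℝ, E) x₀).target, chartParam E x₀ y = p :=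
  ⟨p, extChartAt 𝓘(ℝ, E) p p, mem_extChartAt_target p, extChartAt_to_inv p⟩

variable [RiemannianBundle (fun x : M ↦ TangentSpace 𝓘(ℝ, E) x)]
  [IsContMDiffRiemannianBundle 𝓘(ℝ, E) ∞ E (fun x : M ↦ TangentSpace 𝓘(ℝ, E) x)]

/-- A curve with vanishing acceleration has constant speed. -/
lemma inner_velocity_eq_of_geodesic {U : Set E} (hU : IsOpen U) {Φ : E → M}
    (hΦ : ContMDiffOn 𝓘(ℝ, E) 𝓘(ℝ, E) ∞ Φ U) {c : ℝ → E} {J : Set ℝ} (hJ : IsOpen J)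
    (hJ' : IsPreconnected J) (hcJ : ContDiffOn ℝ ∞ c J) (hcU : MapsTo c J U)
    (hgeo : ∀ t ∈ J, covDerivCurve (E := E) (Φ ∘ c) (velocity (Φ ∘ c)) t = 0)
    {s t : ℝ} (hs : s ∈ J) (ht : t ∈ J) :
    inner ℝ (velocity (E := E) (Φ ∘ c) s) (velocity (Φ ∘ c) s) =
      inner ℝ (velocity (E := E) (Φ ∘ c) t) (velocity (Φ ∘ c) t) := by
  have hd (s) (hs : s ∈ J) : DifferentiableAt ℝ c s :=
    (hcJ.contDiffAt (hJ.mem_nhds hs)).differentiableAt (by simp)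
  have hΦd (s) (hs : s ∈ J) : MDifferentiableAt 𝓘(ℝ, E) 𝓘(ℝ, E) Φ (c s) :=
    (hΦ.contMDiffAt (hU.mem_nhds (hcU hs))).mdifferentiableAt (by simp)
  have key (s) (hs : s ∈ J) : DifferentiableAt ℝ
      (fun s ↦ inner ℝ (velocity (E := E) (Φ ∘ c) s) (velocity (Φ ∘ c) s)) s ∧
      deriv (fun s ↦ inner ℝ (velocity (E := E) (Φ ∘ c) s) (velocity (Φ ∘ c) s)) s = 0 := by
    have hdd : DifferentiableAt ℝ (deriv c) s :=
      ((hcJ.deriv_of_isOpen (m := ∞) hJ (by simp)).contDiffAt (hJ.mem_nhds hs)).differentiableAt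
        (by simp)
    have h1 : DifferentiableAt ℝ (vecRep (E := E) ((Φ ∘ c) s) (Φ ∘ c) (velocity (Φ ∘ c))) s := by
      refine (hasFDerivAt_vecRep_differential hU hΦ (hcU hs) (hd s hs) hdd
        (mem_chart_source E (Φ (c s)))).differentiableAt.congr_of_eventuallyEq ?_
      filter_upwards [hJ.mem_nhds hs] with r hr
      simp only [vecRep]
      rw [velocity_comp (hΦd r hr) (hd r hr)]
      rfl
    obtain ⟨h2, h3⟩ := fderiv_inner_eq_covDeriv
      ((hΦd s hs).comp s (hd s hs).mdifferentiableAt) h1 h1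
    refine ⟨h2, ?_⟩
    rw [← fderiv_apply_one_eq_deriv, h3 1]
    have h4 := hgeo s hs
    rw [covDerivCurve] at h4
    rw [h4, inner_zero_left, inner_zero_right, add_zero]
  exact hJ.is_const_of_deriv_eq_zero hJ' (fun s hs ↦ (key s hs).1.differentiableWithinAt)
    (fun s hs ↦ (key s hs).2) hs ht

/-- Unit-speed geodesics with given initial position and velocity exist; they are kept in the form
`chartParam E x₀ ∘ c`, together with the geodesic equation of `c`. -/
theorem exists_geodesic {x₀ : M} {y : E} (hy : y ∈ (extChartAt 𝓘(ℝ, E) x₀).target) {v : E}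
    (hv : gram E (chartParam E x₀) y v v = 1) :
    ∃ ε > 0, ∃ c : ℝ → E, c 0 = y ∧ deriv c 0 = v ∧ ContDiffOn ℝ ∞ c (Ioo (-ε) ε) ∧
      MapsTo c (Ioo (-ε) ε) (extChartAt 𝓘(ℝ, E) x₀).target ∧
      (∀ t ∈ Ioo (-ε) ε, deriv (deriv c) t =
        -metricChristoffel (gram E (chartParam E x₀)) (c t) (deriv c t) (deriv c t)) ∧
      IsGeodesicOn (E := E) (chartParam E x₀ ∘ c) (Ioo (-ε) ε) := by
  have hU := isOpen_extChartAt_target (I := 𝓘(ℝ, E)) x₀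
  have hΦ := contMDiffOn_chartParam (E := E) x₀
  obtain ⟨ε, hε, c, h0, h0', hc, hg⟩ := exists_metric_geodesic hU
    (fun y hy ↦ contDiffAt_gram hU hΦ hy)
    (fun y hy ↦ isInvertible_gram (bijective_differential_chartParam hy).1) hy v
  have hcU : MapsTo c (Ioo (-ε) ε) (extChartAt 𝓘(ℝ, E) x₀).target := fun t ht ↦ (hg t ht).1
  have hgeo : ∀ t ∈ Ioo (-ε) ε, covDerivCurve (E := E) (chartParam E x₀ ∘ c)
      (velocity (chartParam E x₀ ∘ c)) t = 0 := by
    intro t ht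
    rw [covDerivCurve_velocity hU hΦ isOpen_Ioo hc hcU ht,
      hess_eq_differential_metricChristoffel hU hΦ (hcU ht)
        (bijective_differential_chartParam (hcU ht)), ← map_add, (hg t ht).2.deriv,
      add_neg_cancel, map_zero]
  have h00 : (0 : ℝ) ∈ Ioo (-ε) ε := ⟨by linarith, hε⟩
  refine ⟨ε, hε, c, h0, h0', hc, hcU, fun t ht ↦ (hg t ht).2.deriv, ⟨⟨?_, fun t ht ↦ ?_⟩, hgeo⟩⟩
  · exact hΦ.comp hc.contMDiffOn hcU
  · rw [inner_velocity_eq_of_geodesic hU hΦ isOpen_Ioo isPreconnected_Ioo hc hcU hgeo ht h00,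
      velocity_comp ((hΦ.contMDiffAt (hU.mem_nhds (hcU h00))).mdifferentiableAt (by simp))
      ((hc.contDiffAt (isOpen_Ioo.mem_nhds h00)).differentiableAt (by simp)),
      ← gram_apply, h0, h0', hv]

end Geodesic

/-! ### Smoothness of the Hessian -/

section HessCoord

variable {E : Type*} [NormedAddCommGroup E] [NormedSpace ℝ E] [FiniteDimensional ℝ E]
  {X : Type*} [TopologicalSpace X] [ChartedSpace E X] [IsManifold 𝓘(ℝ, E) ∞ X]
  {N : Type*} [NormedAddCommGroup N] [NormedSpace ℝ N] [FiniteDimensional ℝ N]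

variable [RiemannianBundle (fun x : X ↦ TangentSpace 𝓘(ℝ, E) x)]

/-- The Hessian depends only on the germ of the map. The statement compares components, since the
two Hessians lie in tangent spaces that are not definitionally equal. -/
lemma toCoord_hess_congr {U : Set N} (hU : IsOpen U) {Φ Φ' : N → X}
    (hΦ : ContMDiffOn 𝓘(ℝ, N) 𝓘(ℝ, E) ∞ Φ U) (h : EqOn Φ' Φ U) {y : N} (hy : y ∈ U)
    (x₀ : X) (u v : N) :
    toCoord x₀ (Φ y) (hess (E := E) Φ y u v) = toCoord x₀ (Φ' y) (hess Φ' y u v) := by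
  have hΦ' : ContMDiffOn 𝓘(ℝ, N) 𝓘(ℝ, E) ∞ Φ' U := hΦ.congr h
  have key : ∀ {Ξ : N → X} (hΞ : ContMDiffOn 𝓘(ℝ, N) 𝓘(ℝ, E) ∞ Ξ U) (q : X), Ξ y = q →
      toCoord x₀ (Ξ y) (hess (E := E) Ξ y u v) = toCoord x₀ q (ofCoord q q
      (fderiv ℝ (fderiv ℝ (extChartAt 𝓘(ℝ, E) q ∘ Ξ)) y u v) +
      christoffel q (ofCoord q q (fderiv ℝ (extChartAt 𝓘(ℝ, E) q ∘ Ξ) y u))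
        (ofCoord q q (fderiv ℝ (extChartAt 𝓘(ℝ, E) q ∘ Ξ) y v))) := by
    rintro Ξ hΞ q rfl
    have hd := (hΞ.contMDiffAt (hU.mem_nhds hy)).mdifferentiableAt (by simp)
    have hx := mem_chart_source E (Ξ y)
    rw [hess_eq hU hΞ hy, fderiv_extChartAt_comp hx hd, fderiv_extChartAt_comp hx hd,
      ofCoord_toCoord hx, ofCoord_toCoord hx]
  rw [key hΦ _ rfl, key hΦ' (Φ y) (h hy)]
  have h1 : extChartAt 𝓘(ℝ, E) (Φ y) ∘ Φ' =ᶠ[𝓝 y] extChartAt 𝓘(ℝ, E) (Φ y) ∘ Φ := by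
    filter_upwards [hU.mem_nhds hy] with z hz
    simp only [Function.comp_apply, h hz]
  rw [h1.fderiv.fderiv_eq, h1.fderiv_eq]

variable [IsContMDiffRiemannianBundle 𝓘(ℝ, E) ∞ E (fun x : X ↦ TangentSpace 𝓘(ℝ, E) x)]

/-- The components of the Hessian in a fixed chart. By contrast, `hess_eq` uses a chart which varies
with the point, and says nothing about smoothness. -/
lemma toCoord_hess {U : Set N} (hU : IsOpen U) {Φ : N → X}
    (hΦ : ContMDiffOn 𝓘(ℝ, N) 𝓘(ℝ, E) ∞ Φ U) {x₀ : X}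
    (hUx : MapsTo Φ U (chartAt E x₀).source) {y : N} (hy : y ∈ U) (u v : N) :
    toCoord x₀ (Φ y) (hess (E := E) Φ y u v) =
      metricChristoffel (gram E (chartParam E x₀)) (extChartAt 𝓘(ℝ, E) x₀ (Φ y))
        (fderiv ℝ (extChartAt 𝓘(ℝ, E) x₀ ∘ Φ) y u) (fderiv ℝ (extChartAt 𝓘(ℝ, E) x₀ ∘ Φ) y v) +
      fderiv ℝ (fderiv ℝ (extChartAt 𝓘(ℝ, E) x₀ ∘ Φ)) y u v := by
  set C := extChartAt 𝓘(ℝ, E) x₀ ∘ Φ with hC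
  have hs (z) (hz : z ∈ U) : Φ z ∈ (extChartAt 𝓘(ℝ, E) x₀).source := by
    rw [extChartAt_source]; exact hUx hz
  have hΦC : EqOn (chartParam E x₀ ∘ C) Φ U := fun z hz ↦
    (extChartAt 𝓘(ℝ, E) x₀).left_inv (hs z hz)
  have hCs : ContDiffAt ℝ ∞ C y :=
    contDiffAt_extChartAt_comp (hUx hy) (hΦ.contMDiffAt (hU.mem_nhds hy))
  have hCd (z) (hz : z ∈ U) : DifferentiableAt ℝ C z :=
    (contDiffAt_extChartAt_comp (hUx hz) (hΦ.contMDiffAt (hU.mem_nhds hz))).differentiableAt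
      (by simp)
  have hCt : ∀ z ∈ U, C z ∈ (extChartAt 𝓘(ℝ, E) x₀).target := fun z hz ↦
    (extChartAt 𝓘(ℝ, E) x₀).map_source (hs z hz)
  have hT := isOpen_extChartAt_target (I := 𝓘(ℝ, E)) x₀
  have hP := contMDiffOn_chartParam (E := E) x₀
  rw [toCoord_hess_congr hU hΦ hΦC hy]
  have h1 : hess (E := E) (chartParam E x₀ ∘ C) y u v = covDeriv (chartParam E x₀ ∘ C)
      (fun z ↦ differential (chartParam E x₀) (C z) (fderiv ℝ C z v)) y u := by
    refine covDeriv_congr ?_ _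
    filter_upwards [hU.mem_nhds hy] with z hz
    exact differential_comp ((hP.contMDiffAt (hT.mem_nhds (hCt z hz))).mdifferentiableAt (by simp))
      (hCd z hz) v
  have hV : DifferentiableAt ℝ (fun z ↦ fderiv ℝ C z v) y :=
    ((hCs.fderiv_right (m := ∞) (by simp)).differentiableAt (by simp)).clm_apply
      (differentiableAt_const v)
  have hV' : fderiv ℝ (fun z ↦ fderiv ℝ C z v) y u = fderiv ℝ (fderiv ℝ C) y u v := by
    rw [fderiv_clm_apply ((hCs.fderiv_right (m := ∞) (by simp)).differentiableAt (by simp))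
      (differentiableAt_const v)]
    simp
  rw [h1, covDeriv_differential_comp hT hP (hCt y hy) (hCd y hy) hV,
    hess_eq_differential_metricChristoffel hT hP (hCt y hy)
      (bijective_differential_chartParam (hCt y hy)), map_add]
  simp only [Function.comp_apply]
  rw [toCoord_differential_chartParam (hCt y hy), toCoord_differential_chartParam (hCt y hy), hV']
  rfl

lemma contDiffAt_toCoord_hess {U : Set N} (hU : IsOpen U) {Φ : N → X}
    (hΦ : ContMDiffOn 𝓘(ℝ, N) 𝓘(ℝ, E) ∞ Φ U) {x₀ : X} {y : N} (hy : y ∈ U)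
    (hx : Φ y ∈ (chartAt E x₀).source) (u v : N) :
    ContDiffAt ℝ ∞ (fun z ↦ toCoord x₀ (Φ z) (hess (E := E) Φ z u v)) y := by
  set U' := U ∩ Φ ⁻¹' (chartAt E x₀).source with hU'
  have hUo : IsOpen U' := hΦ.continuousOn.isOpen_inter_preimage hU (chartAt E x₀).open_source
  have hΦ' := hΦ.mono (inter_subset_left : U' ⊆ U)
  have hm : MapsTo Φ U' (chartAt E x₀).source := fun z hz ↦ hz.2
  have hy' : y ∈ U' := ⟨hy, hx⟩
  have hC : ContDiffAt ℝ ∞ (extChartAt 𝓘(ℝ, E) x₀ ∘ Φ) y :=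
    contDiffAt_extChartAt_comp hx (hΦ.contMDiffAt (hU.mem_nhds hy))
  have hT := isOpen_extChartAt_target (I := 𝓘(ℝ, E)) x₀
  have hP := contMDiffOn_chartParam (E := E) x₀
  have hyt : (extChartAt 𝓘(ℝ, E) x₀ ∘ Φ) y ∈ (extChartAt 𝓘(ℝ, E) x₀).target :=
    (extChartAt 𝓘(ℝ, E) x₀).map_source (by rw [extChartAt_source]; exact hx)
  have h1 : ContDiffAt ℝ ∞ (fderiv ℝ (extChartAt 𝓘(ℝ, E) x₀ ∘ Φ)) y :=
    hC.fderiv_right (m := ∞) (by simp)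
  have h2 : ContDiffAt ℝ ∞ (fderiv ℝ (fderiv ℝ (extChartAt 𝓘(ℝ, E) x₀ ∘ Φ))) y :=
    h1.fderiv_right (m := ∞) (by simp)
  refine ContDiffAt.congr_of_eventuallyEq (f := fun z ↦
    metricChristoffel (gram E (chartParam E x₀)) ((extChartAt 𝓘(ℝ, E) x₀ ∘ Φ) z)
        (fderiv ℝ (extChartAt 𝓘(ℝ, E) x₀ ∘ Φ) z u) (fderiv ℝ (extChartAt 𝓘(ℝ, E) x₀ ∘ Φ) z v) +
      fderiv ℝ (fderiv ℝ (extChartAt 𝓘(ℝ, E) x₀ ∘ Φ)) z u v) ?_ ?_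
  · exact (contDiffAt_metricChristoffel (contDiffAt_gram hT hP hyt)
      (isInvertible_gram (bijective_differential_chartParam hyt).1) hC
      (h1.clm_apply contDiffAt_const) (h1.clm_apply contDiffAt_const)).add
      ((h2.clm_apply contDiffAt_const).clm_apply contDiffAt_const)
  · filter_upwards [hUo.mem_nhds hy'] with z hz
    exact toCoord_hess hUo hΦ' hm hz u v

end HessCoord

/-! ### Tangential and normal parts along an isometric immersion -/

section Immersion

variable {E : Type*} [NormedAddCommGroup E] [NormedSpace ℝ E] [FiniteDimensional ℝ E]
  {M : Type*} [TopologicalSpace M] [ChartedSpace E M] [IsManifold 𝓘(ℝ, E) ∞ M]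
  [RiemannianBundle (fun x : M ↦ TangentSpace 𝓘(ℝ, E) x)]
  {F : Type*} [NormedAddCommGroup F] [NormedSpace ℝ F] [FiniteDimensional ℝ F]
  {Q : Type*} [TopologicalSpace Q] [ChartedSpace F Q] [IsManifold 𝓘(ℝ, F) ∞ Q]
  [RiemannianBundle (fun x : Q ↦ TangentSpace 𝓘(ℝ, F) x)]
  {ι : M → Q} (hι : IsIsometricImmersion (E := E) (F := F) ι) {x₀ : M}

include hι

lemma contMDiffOn_immersion_chartParam :
    ContMDiffOn 𝓘(ℝ, E) 𝓘(ℝ, F) ∞ (ι ∘ chartParam E x₀) (extChartAt 𝓘(ℝ, E) x₀).target :=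
  hι.1.comp_contMDiffOn (contMDiffOn_chartParam x₀)

variable {y : E} (hy : y ∈ (extChartAt 𝓘(ℝ, E) x₀).target)
include hy

lemma differential_immersion (u : E) :
    differential (E := F) (ι ∘ chartParam E x₀) y u =
      mfderiv 𝓘(ℝ, E) 𝓘(ℝ, F) ι (chartParam E x₀ y) (differential (chartParam E x₀) y u) :=
  mfderiv_comp_apply y (hι.1.mdifferentiableAt (by simp))
    (((contMDiffOn_chartParam (E := E) x₀).contMDiffAt
      ((isOpen_extChartAt_target x₀).mem_nhds hy)).mdifferentiableAt (by simp)) u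

lemma gram_immersion : gram F (ι ∘ chartParam E x₀) y = gram E (chartParam E x₀) y := by
  ext u v
  rw [gram_apply, gram_apply, differential_immersion hι hy, differential_immersion hι hy]
  exact hι.2 _ _ _

lemma injective_differential_immersion :
    Function.Injective (differential (E := F) (ι ∘ chartParam E x₀) y) := by
  intro u v h
  have h1 : ∀ w, gram E (chartParam E x₀) y u w = gram E (chartParam E x₀) y v w := fun w ↦ by
    rw [← gram_immersion hι hy, gram_apply, gram_apply, h]
  have h2 : gram E (chartParam E x₀) y (u - v) (u - v) = 0 := by
    rw [(gram E (chartParam E x₀) y).map_sub u v, ContinuousLinearMap.ext h1, sub_self]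
    rfl
  rw [gram_apply, inner_self_eq_zero] at h2
  exact sub_eq_zero.1 ((bijective_differential_chartParam hy).1 (by rw [h2, map_zero]))

lemma mem_tangentRange_iff {v : TangentSpace 𝓘(ℝ, F) (ι (chartParam E x₀ y))} :
    v ∈ tangentRange (E := E) ι (chartParam E x₀ y) ↔
      ∃ u, differential (E := F) (ι ∘ chartParam E x₀) y u = v := by
  constructor
  · rintro ⟨w, rfl⟩
    obtain ⟨u, rfl⟩ := (bijective_differential_chartParam hy).2 w
    exact ⟨u, differential_immersion hι hy u⟩
  · rintro ⟨u, rfl⟩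
    exact ⟨differential (chartParam E x₀) y u, (differential_immersion hι hy u).symm⟩

lemma mem_normalSpace_iff {v : TangentSpace 𝓘(ℝ, F) (ι (chartParam E x₀ y))} :
    v ∈ normalSpace (E := E) ι (chartParam E x₀ y) ↔
      ∀ u, inner ℝ (differential (E := F) (ι ∘ chartParam E x₀) y u) v = 0 := by
  rw [normalSpace, Submodule.mem_orthogonal]
  constructor
  · exact fun h u ↦ h _ ((mem_tangentRange_iff hι hy).2 ⟨u, rfl⟩)
  · intro h w hw
    obtain ⟨u, rfl⟩ := (mem_tangentRange_iff hι hy).1 hw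
    exact h u

lemma tangentPart_differential (u : E) :
    tangentPart (E := E) ι (chartParam E x₀ y) (differential (E := F) (ι ∘ chartParam E x₀) y u) =
      differential (E := F) (ι ∘ chartParam E x₀) y u :=
  Submodule.starProjection_eq_self_iff.2 ((mem_tangentRange_iff hι hy).2 ⟨u, rfl⟩)

lemma normalPart_differential (u : E) :
    normalPart (E := E) ι (chartParam E x₀ y) (differential (E := F) (ι ∘ chartParam E x₀) y u) =
      0 := by
  rw [normalPart, tangentPart_differential hι hy, sub_self]

omit hι hy in
lemma normalPart_add (p : M) (v w : TangentSpace 𝓘(ℝ, F) (ι p)) :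
    normalPart (E := E) ι p (v + w) = normalPart (E := E) ι p v + normalPart (E := E) ι p w := by
  simp only [normalPart, tangentPart, map_add]; abel

omit hι hy in
lemma normalPart_mem (p : M) (v : TangentSpace 𝓘(ℝ, F) (ι p)) :
    normalPart (E := E) ι p v ∈ normalSpace (E := E) ι p :=
  Submodule.sub_starProjection_mem_orthogonal v

omit hι hy in
lemma normalPart_eq_self {p : M} {v : TangentSpace 𝓘(ℝ, F) (ι p)}
    (hv : v ∈ normalSpace (E := E) ι p) : normalPart (E := E) ι p v = v := by
  rw [normalPart, tangentPart, (Submodule.starProjection_apply_eq_zero_iff _).2 hv, sub_zero]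

lemma inner_tangentPart_differential (v : TangentSpace 𝓘(ℝ, F) (ι (chartParam E x₀ y))) (u : E) :
    inner ℝ (tangentPart (E := E) ι (chartParam E x₀ y) v)
      (differential (E := F) (ι ∘ chartParam E x₀) y u) =
    inner ℝ v (differential (E := F) (ι ∘ chartParam E x₀) y u) := by
  have h := (mem_normalSpace_iff hι hy).1 (normalPart_mem (E := E) _ v) u
  rw [normalPart, inner_sub_right, sub_eq_zero] at h
  rw [real_inner_comm, ← h, real_inner_comm]

/-- The tangential projection in terms of the inverse of the pulled-back metric, which shows its
smooth dependence on the point. -/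
lemma tangentPart_eq (v : TangentSpace 𝓘(ℝ, F) (ι (chartParam E x₀ y))) :
    tangentPart (E := E) ι (chartParam E x₀ y) v =
      differential (E := F) (ι ∘ chartParam E x₀) y
        ((gram F (ι ∘ chartParam E x₀) y).inverse
          ((innerSL ℝ v).comp (differential (E := F) (ι ∘ chartParam E x₀) y))) := by
  obtain ⟨a, ha⟩ := (mem_tangentRange_iff hι hy).1
    (Submodule.starProjection_apply_mem (tangentRange (E := E) ι (chartParam E x₀ y)) v)
  have hinv := isInvertible_gram (injective_differential_immersion hι hy)
  have h : (innerSL ℝ v).comp (differential (E := F) (ι ∘ chartParam E x₀) y)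
      = gram F (ι ∘ chartParam E x₀) y a := by
    ext w
    rw [gram_apply, ha]
    exact (inner_tangentPart_differential hι hy v w).symm
  rw [h, hinv.inverse_apply_eq.2 rfl, ha]
  rfl

variable [IsContMDiffRiemannianBundle 𝓘(ℝ, F) ∞ F (fun x : Q ↦ TangentSpace 𝓘(ℝ, F) x)]

/-- The normal part of a smooth vector field along the immersion is smooth. -/
lemma contDiffAt_vecRep_normalPart {x₁ : Q}
    (hx : (ι ∘ chartParam E x₀) y ∈ (chartAt F x₁).source)
    {V : ∀ z : E, TangentSpace 𝓘(ℝ, F) ((ι ∘ chartParam E x₀) z)}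
    (hV : ContDiffAt ℝ ∞ (vecRep x₁ (ι ∘ chartParam E x₀) V) y) :
    ContDiffAt ℝ ∞ (vecRep x₁ (ι ∘ chartParam E x₀)
      (fun z ↦ normalPart (E := E) ι (chartParam E x₀ z) (V z))) y := by
  have hU := isOpen_extChartAt_target (I := 𝓘(ℝ, E)) x₀
  have hf := contMDiffOn_immersion_chartParam (x₀ := x₀) hι
  have hfy := hf.contMDiffAt (hU.mem_nhds hy)
  have hC : ContDiffAt ℝ ∞ (fderiv ℝ (extChartAt 𝓘(ℝ, F) x₁ ∘ ι ∘ chartParam E x₀)) y :=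
    (contDiffAt_extChartAt_comp hx hfy).fderiv_right (m := ∞) (by simp)
  have hev := vecRep_differential_eventuallyEq hU hf hy hx
  have hl : ContDiffAt ℝ ∞ (fun z ↦ (innerSL ℝ (V z)).comp
      (differential (E := F) (ι ∘ chartParam E x₀) z)) y := by
    refine contDiffAt_clm fun w ↦ ?_
    refine (((contDiffAt_chartMetric_comp hx hfy).clm_apply hV).clm_apply
      (hC.clm_apply (contDiffAt_const (c := w)))).congr_of_eventuallyEq ?_
    filter_upwards [hev, hfy.continuousAt.preimage_mem_nhds
      ((chartAt F x₁).open_source.mem_nhds hx)] with z hz hz'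
    rw [ContinuousLinearMap.comp_apply, innerSL_apply_apply, inner_eq_chartMetric hz', hz, vecRep]
  have hG := contDiffAt_inverse (contDiffAt_gram hU hf hy)
    (isInvertible_gram (injective_differential_immersion hι hy))
  refine (hV.sub (hC.clm_apply (hG.clm_apply hl))).congr_of_eventuallyEq ?_
  filter_upwards [hev, hU.mem_nhds hy] with z hz hzU
  rw [← hz, vecRep, normalPart, tangentPart_eq hι hzU, map_sub]
  rfl

end Immersion

/-! ### The second fundamental form and the shape operator in a chart -/

section SmoothFields
variable {E : Type*} [NormedAddCommGroup E] [NormedSpace ℝ E]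
  {X : Type*} [TopologicalSpace X] [ChartedSpace E X] [IsManifold 𝓘(ℝ, E) ∞ X]
  {N : Type*} [NormedAddCommGroup N] [NormedSpace ℝ N]

/-- Near `p`, the local extension of a tangent vector at `p` has constant components in the
preferred chart at `p`. -/
lemma extend_eventuallyEq {p : X} (v : TangentSpace 𝓘(ℝ, E) p) :
    ∀ᶠ q in 𝓝 p, (FiberBundle.extend E v q : TangentSpace 𝓘(ℝ, E) q)
      = ofCoord p q (toCoord p p v) := by
  filter_upwards [(chartAt E p).open_source.mem_nhds (mem_chart_source E p)] with q hq
  simp only [FiberBundle.extend]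
  rw [trivializationAt_symm hq, trivializationAt_snd (mem_chart_source E p)]

lemma contDiffAt_vecRep_of_contMDiffAt {f : N → X} {V : ∀ q, TangentSpace 𝓘(ℝ, E) (f q)} {p : N}
    (h : ContMDiffAt 𝓘(ℝ, N) 𝓘(ℝ, E).tangent ∞
      (fun q ↦ (⟨f q, V q⟩ : TangentBundle 𝓘(ℝ, E) X)) p) {x₀ : X}
    (hx : f p ∈ (chartAt E x₀).source) :
    ContDiffAt ℝ ∞ (vecRep x₀ f V) p := by
  have h1 := ((trivializationAt E (TangentSpace 𝓘(ℝ, E) : X → Type _) x₀).contMDiffAt_iff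
    (IB := 𝓘(ℝ, E)) (n := ∞) (f := fun q ↦ (⟨f q, V q⟩ : TangentBundle 𝓘(ℝ, E) X)) (x₀ := p)
    (by exact hx)).1 h
  exact h1.2.contDiffAt.congr_of_eventuallyEq
    (vecRep_eventuallyEq hx h1.1.continuousAt V).symm

end SmoothFields

section Immersion

variable {E : Type*} [NormedAddCommGroup E] [NormedSpace ℝ E] [FiniteDimensional ℝ E]
  {M : Type*} [TopologicalSpace M] [ChartedSpace E M] [IsManifold 𝓘(ℝ, E) ∞ M]
  [RiemannianBundle (fun x : M ↦ TangentSpace 𝓘(ℝ, E) x)]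
  {F : Type*} [NormedAddCommGroup F] [NormedSpace ℝ F] [FiniteDimensional ℝ F]
  {Q : Type*} [TopologicalSpace Q] [ChartedSpace F Q] [IsManifold 𝓘(ℝ, F) ∞ Q]
  [RiemannianBundle (fun x : Q ↦ TangentSpace 𝓘(ℝ, F) x)]
  {ι : M → Q} (hι : IsIsometricImmersion (E := E) (F := F) ι) {x₀ : M}
  {y : E} (hy : y ∈ (extChartAt 𝓘(ℝ, E) x₀).target)

include hι hy

/-- Covariant derivatives along `ι` can be computed in a parametrization of `M`. -/
lemma covDeriv_immersion {W : ∀ q : M, TangentSpace 𝓘(ℝ, F) (ι q)}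
    (hW : DifferentiableAt ℝ (vecRep ((ι ∘ chartParam E x₀) y) (ι ∘ chartParam E x₀)
      (fun z ↦ W (chartParam E x₀ z))) y) (u : E) :
    covDeriv (E := F) ι W (chartParam E x₀ y) (differential (E := E) (chartParam E x₀) y u) =
      covDeriv (E := F) (ι ∘ chartParam E x₀) (fun z ↦ W (chartParam E x₀ z)) y u := by
  have hU := isOpen_extChartAt_target (I := 𝓘(ℝ, E)) x₀
  have hP := ((contMDiffOn_chartParam (E := E) x₀).contMDiffAt (hU.mem_nhds hy))
  have hf := ((contMDiffOn_immersion_chartParam (x₀ := x₀) hι).contMDiffAt (hU.mem_nhds hy))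
  set g : M → F := fun q : M ↦ (trivializationAt F (TangentSpace 𝓘(ℝ, F) : Q → Type _)
    (ι (chartParam E x₀ y)) (⟨ι q, W q⟩ : TangentBundle 𝓘(ℝ, F) Q)).2 with hg
  have h1 : DifferentiableAt ℝ (g ∘ chartParam E x₀) y :=
    hW.congr_of_eventuallyEq
      (vecRep_eventuallyEq (mem_chart_source F _) hf.continuousAt (fun z ↦ W (chartParam E x₀ z)))
  have hs := chartParam_mem_source hy
  have h2 : MDifferentiableAt 𝓘(ℝ, E) 𝓘(ℝ, F) g (chartParam E x₀ y) := by
    have h3 : MDifferentiableAt 𝓘(ℝ, E) 𝓘(ℝ, F)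
        ((g ∘ chartParam E x₀) ∘ extChartAt 𝓘(ℝ, E) x₀) (chartParam E x₀ y) := by
      refine MDifferentiableAt.comp (I' := 𝓘(ℝ, E)) _ ?_ (mdifferentiableAt_extChartAt hs)
      rw [(extChartAt 𝓘(ℝ, E) x₀).right_inv hy]
      exact h1.mdifferentiableAt
    refine h3.congr_of_eventuallyEq ?_
    filter_upwards [(chartAt E x₀).open_source.mem_nhds hs] with q hq
    exact congrArg g ((extChartAt 𝓘(ℝ, E) x₀).left_inv (by rwa [extChartAt_source])).symm
  have h4 := mfderiv_comp_apply y h2 (hP.mdifferentiableAt (by simp)) u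
  have h5 := differential_immersion hι hy u
  unfold covDeriv mvfderiv
  refine congr_arg₂ (· + ·) (congrArg _ ?_) ?_
  · exact h4.symm
  · exact congrArg (fun w ↦ christoffel (E := F) (ι (chartParam E x₀ y)) w
      (W (chartParam E x₀ y))) h5.symm

variable [IsContMDiffRiemannianBundle 𝓘(ℝ, F) ∞ F (fun x : Q ↦ TangentSpace 𝓘(ℝ, F) x)]

/-- The second fundamental form is the normal part of the Hessian of the immersion in a chart of
`M`. -/
theorem secondFundamentalForm_eq (u v : E) :
    secondFundamentalForm (F := F) ι (chartParam E x₀ y)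
      (differential (E := E) (chartParam E x₀) y u)
      (differential (E := E) (chartParam E x₀) y v) =
    normalPart (E := E) ι (chartParam E x₀ y) (hess (ι ∘ chartParam E x₀) y u v) := by
  have hU := isOpen_extChartAt_target (I := 𝓘(ℝ, E)) x₀
  have hPo := contMDiffOn_chartParam (E := E) x₀
  have hP := (hPo.contMDiffAt (hU.mem_nhds hy))
  have hfo := contMDiffOn_immersion_chartParam (x₀ := x₀) hι
  set p := chartParam E x₀ y with hp
  set v' : TangentSpace 𝓘(ℝ, E) p := differential (E := E) (chartParam E x₀) y v with hv'
  -- `b` is the local extension of `v'`, read in the parametrization.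
  set b : E → E := fun z ↦ toCoord x₀ (chartParam E x₀ z)
    (FiberBundle.extend E v' (chartParam E x₀ z)) with hb
  have hby : b y = v := by
    simp only [hb]
    rw [← hp, FiberBundle.extend_apply_self, hv']
    exact toCoord_differential_chartParam hy v
  have hbd : DifferentiableAt ℝ b y := by
    have h1 : ContMDiffAt 𝓘(ℝ, E) 𝓘(ℝ, E).tangent ∞ (fun z ↦ (⟨chartParam E x₀ z,
        ofCoord p (chartParam E x₀ z) (toCoord p p v')⟩ : TangentBundle 𝓘(ℝ, E) M)) y :=
      ((contMDiffOn_ofCoord p (toCoord p p v')).contMDiffAt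
        ((chartAt E p).open_source.mem_nhds (mem_chart_source E p))).comp y hP
    have h2 := contDiffAt_vecRep_of_contMDiffAt (f := chartParam E x₀) h1
      (chartParam_mem_source hy)
    refine (h2.differentiableAt (by simp)).congr_of_eventuallyEq ?_
    filter_upwards [hP.continuousAt.eventually (extend_eventuallyEq v')] with z hz
    simp only [hb, vecRep, hz]
  have hW : ∀ z ∈ (extChartAt 𝓘(ℝ, E) x₀).target,
      mfderiv 𝓘(ℝ, E) 𝓘(ℝ, F) ι (chartParam E x₀ z) (FiberBundle.extend E v' (chartParam E x₀ z))
      = differential (E := F) (ι ∘ chartParam E x₀) z (b z) := by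
    intro z hz
    rw [differential_immersion hι hz, hb, differential_chartParam_toCoord hz]
  have hev : ∀ᶠ z in 𝓝 y, mfderiv 𝓘(ℝ, E) 𝓘(ℝ, F) ι (chartParam E x₀ z)
      (FiberBundle.extend E v' (chartParam E x₀ z))
      = differential (E := F) (ι ∘ chartParam E x₀) z (b z) := by
    filter_upwards [hU.mem_nhds hy] with z hz using hW z hz
  have hdiff : DifferentiableAt ℝ (vecRep ((ι ∘ chartParam E x₀) y) (ι ∘ chartParam E x₀)
      (fun z ↦ mfderiv 𝓘(ℝ, E) 𝓘(ℝ, F) ι (chartParam E x₀ z)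
        (FiberBundle.extend E v' (chartParam E x₀ z)))) y := by
    refine (differentiableAt_vecRep_differential hU hfo hy hbd
      (mem_chart_source F _)).congr_of_eventuallyEq ?_
    filter_upwards [hev] with z hz
    exact congrArg _ hz
  have hcov := covDeriv_differential_comp hU hfo (c := id) (s := y) hy differentiableAt_id hbd u
  simp only [Function.comp_id, id_eq, fderiv_id, ContinuousLinearMap.id_apply] at hcov
  have h1 := covDeriv_immersion hι hy (W := fun q ↦ mfderiv 𝓘(ℝ, E) 𝓘(ℝ, F) ι q
    (FiberBundle.extend E v' q)) hdiff u
  have h2 := covDeriv_congr (f := ι ∘ chartParam E x₀) hev u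
  rw [secondFundamentalForm, h1.trans (h2.trans hcov), hby, normalPart_add,
    normalPart_differential hι hy, add_zero]

/-- The Weingarten relation `⟨A_η(x), y⟩ = -⟨η, α(x, y)⟩`, from differentiating `⟨N, dι(Y)⟩ = 0`. -/
theorem inner_shapeOperator {η : TangentSpace 𝓘(ℝ, F) (ι (chartParam E x₀ y))}
    (hη : η ∈ normalSpace (E := E) ι (chartParam E x₀ y)) (u w : E) :
    inner ℝ (shapeOperator ι (chartParam E x₀ y) η (differential (E := E) (chartParam E x₀) y u))
      (differential (E := F) (ι ∘ chartParam E x₀) y w) =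
    - inner ℝ η (hess (ι ∘ chartParam E x₀) y u w) := by
  have hU := isOpen_extChartAt_target (I := 𝓘(ℝ, E)) x₀
  have hfo := contMDiffOn_immersion_chartParam (x₀ := x₀) hι
  have hf := hfo.contMDiffAt (hU.mem_nhds hy)
  have hx := mem_chart_source F ((ι ∘ chartParam E x₀) y)
  set V : ∀ z : E, TangentSpace 𝓘(ℝ, F) ((ι ∘ chartParam E x₀) z) :=
    fun z ↦ FiberBundle.extend F η ((ι ∘ chartParam E x₀) z) with hV
  have hVd : ContDiffAt ℝ ∞ (vecRep ((ι ∘ chartParam E x₀) y) (ι ∘ chartParam E x₀) V) y := by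
    refine (contDiffAt_const (c := toCoord (ι (chartParam E x₀ y))
      (ι (chartParam E x₀ y)) η)).congr_of_eventuallyEq ?_
    filter_upwards [hf.continuousAt.eventually (extend_eventuallyEq η),
      hf.continuousAt.preimage_mem_nhds ((chartAt F _).open_source.mem_nhds hx)] with z hz hz'
    rw [vecRep, hV]
    simp only
    rw [hz]
    exact toCoord_ofCoord hz' _
  have hn := (contDiffAt_vecRep_normalPart hι hy hx hVd).differentiableAt (by simp)
  have h0 : (fun z ↦ inner ℝ (normalPart (E := E) ι (chartParam E x₀ z) (V z))
      (differential (E := F) (ι ∘ chartParam E x₀) z w)) =ᶠ[𝓝 y] fun _ ↦ (0 : ℝ) := by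
    filter_upwards [hU.mem_nhds hy] with z hz
    rw [real_inner_comm]
    exact (mem_normalSpace_iff hι hz).1 (normalPart_mem _ _) w
  have h1 := (fderiv_inner_eq_covDeriv (hf.mdifferentiableAt (by simp)) hn
    (differentiableAt_vecRep_differential hU hfo hy (differentiableAt_const w) hx)).2 u
  rw [h0.fderiv_eq] at h1
  have hVy : normalPart (E := E) ι (chartParam E x₀ y) (V y) = η := by
    have : V y = η := FiberBundle.extend_apply_self (F := F)
      (E := (TangentSpace 𝓘(ℝ, F) : Q → Type _)) η
    rw [this, normalPart_eq_self hη]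
  rw [shapeOperator, inner_tangentPart_differential hι hy]
  have h2 := covDeriv_immersion hι hy
    (W := fun q ↦ normalPart (E := E) ι q (FiberBundle.extend F η (ι q))) hn u
  rw [h2, eq_neg_iff_add_eq_zero]
  rw [hVy, fderiv_const_apply] at h1
  exact h1.symm

end Immersion

/-! ### Forms that are multiples of the metric, and linearity of covariant derivatives -/

section Algebra

/-- Let `g` be positive definite, and `h` symmetric and vector-valued. If, for each `v` with
`h v v ≠ 0`, the vectors `g`-orthogonal to `v` are `h`-conjugate to `v`, and more precisely
`h v w` is the multiple `g v w / g v v` of `h v v`, then `h` is a multiple of `g`. No hypothesis is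
made on the vectors with `h v v = 0`, at which a planar geodesic says nothing about `h v w`. -/
lemma exists_eq_smul_of_forall_smul_eq {V W : Type*} [AddCommGroup V] [Module ℝ V]
    [AddCommGroup W] [Module ℝ W] (g : V →ₗ[ℝ] V →ₗ[ℝ] ℝ) (h : V →ₗ[ℝ] V →ₗ[ℝ] W)
    (hgs : ∀ u v, g u v = g v u) (hg : ∀ v, v ≠ 0 → 0 < g v v)
    (hhs : ∀ u v, h u v = h v u)
    (hP : ∀ v, h v v ≠ 0 → ∀ w, g v v • h v w = g v w • h v v) :
    ∃ H : W, ∀ u w, h u w = g u w • H := by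
  -- By polarization it is enough to compare the quadratic forms.
  suffices ∃ H : W, ∀ u, h u u = g u u • H by
    obtain ⟨H, hH⟩ := this
    refine ⟨H, fun u w ↦ ?_⟩
    have h1 := hH (u + w)
    simp only [map_add, LinearMap.add_apply, hH u, hH w, hhs w u, hgs w u] at h1
    have h2 : (2 : ℝ) • h u w = (2 : ℝ) • (g u w • H) := by
      have : g u u • H + h u w + (h u w + g w w • H)
        = g u u • H + g u w • H + (g u w • H + g w w • H) := by
        rw [h1]; module
      rw [two_smul, two_smul]
      have h3 := congrArg (fun x ↦ x - g u u • H - g w w • H) this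
      convert h3 using 1 <;> module
    exact smul_right_injective W (two_ne_zero' ℝ) h2
  by_cases h0 : ∀ v, h v v = 0
  · exact ⟨0, fun u ↦ by rw [h0, smul_zero]⟩
  push Not at h0
  obtain ⟨v, hv⟩ := h0
  have hv0 : v ≠ 0 := fun h ↦ hv (by rw [h, map_zero])
  have hgv := (hg v hv0).ne'
  set H := (g v v)⁻¹ • h v v with hH
  have hvH : h v v = g v v • H := by rw [hH, smul_smul, mul_inv_cancel₀ hgv, one_smul]
  have hH0 : H ≠ 0 := fun h ↦ hv (by rw [hvH, h, smul_zero])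
  have hvw : ∀ w, h v w = g v w • H := fun w ↦ by
    have h1 := hP v hv w
    rw [hvH, smul_comm] at h1
    exact smul_right_injective W hgv h1
  -- For `w` orthogonal to `v`, the hypothesis at `v + t w` gives the identity as soon as
  -- `h (v + t w) (v + t w) ≠ 0`. This cannot fail both for `t = 1` and for `t = 2`.
  have key : ∀ w, g v w = 0 → h w w = g w w • H := by
    intro w hw
    have hvw0 : h v w = 0 := by rw [hvw, hw, zero_smul]
    have hwv0 : h w v = 0 := by rw [hhs, hvw0]
    have hgwv : g w v = 0 := by rw [hgs, hw]
    have main : ∀ t : ℝ, t ≠ 0 → g v v • H + (t ^ 2) • h w w ≠ 0 → h w w = g w w • H := by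
      intro t ht hne
      have e1 : h (v + t • w) (v + t • w) = g v v • H + (t ^ 2) • h w w := by
        simp only [map_add, map_smul, LinearMap.add_apply, LinearMap.smul_apply, hvw0, hwv0, hvH]
        module
      have e2 : g (v + t • w) (v + t • w) = g v v + t ^ 2 * g w w := by
        simp only [map_add, map_smul, LinearMap.add_apply, LinearMap.smul_apply, hw, hgwv,
          smul_eq_mul]
        ring
      have e3 : h (v + t • w) w = t • h w w := by
        simp only [map_add, map_smul, LinearMap.add_apply, LinearMap.smul_apply, hvw0, zero_add]
      have e4 : g (v + t • w) w = t * g w w := by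
        simp only [map_add, map_smul, LinearMap.add_apply, LinearMap.smul_apply, hw, zero_add,
          smul_eq_mul]
      have h1 := hP (v + t • w) (by rwa [e1]) w
      rw [e1, e2, e3, e4] at h1
      have h2 : (t * g v v) • h w w = (t * g v v) • (g w w • H) := by
        have h3 := congrArg (fun x ↦ x - (t ^ 3 * g w w) • h w w) h1
        convert h3 using 1 <;> module
      exact smul_right_injective W (mul_ne_zero ht hgv) h2
    by_cases h1 : g v v • H + ((1 : ℝ) ^ 2) • h w w ≠ 0
    · exact main 1 one_ne_zero h1
    refine main 2 two_ne_zero fun h2 ↦ ?_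
    push Not at h1
    have h3 : (3 * g v v) • H = 0 := by
      have : (4 : ℝ) • (g v v • H + ((1 : ℝ) ^ 2) • h w w) -
          (g v v • H + ((2 : ℝ) ^ 2) • h w w) = 0 := by
        rw [h1, h2]; simp
      rw [← this]; module
    rcases smul_eq_zero.1 h3 with h | h
    · exact hgv (by linarith)
    · exact hH0 h
  -- In general, split `u` into its component along `v` and the orthogonal one.
  refine ⟨H, fun u ↦ ?_⟩
  set a := g v u / g v v with ha
  set w := u - a • v with hw
  have hgw : g v w = 0 := by
    rw [hw, map_sub, map_smul, smul_eq_mul, ha, div_mul_cancel₀ _ hgv, sub_self]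
  have hu : u = a • v + w := by rw [hw]; abel
  have hgwv : g w v = 0 := by rw [hgs, hgw]
  have hvw0 : h v w = 0 := by rw [hvw, hgw, zero_smul]
  have hwv0 : h w v = 0 := by rw [hhs, hvw0]
  rw [hu]
  simp only [map_add, map_smul, LinearMap.add_apply, LinearMap.smul_apply, hvw0, hwv0, hvH,
    key w hgw, hgw, hgwv, smul_eq_mul]
  module

end Algebra

section Linearity

variable {E : Type*} [NormedAddCommGroup E] [NormedSpace ℝ E] [FiniteDimensional ℝ E]
  {X : Type*} [TopologicalSpace X] [ChartedSpace E X] [IsManifold 𝓘(ℝ, E) ∞ X]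
  {N : Type*} [NormedAddCommGroup N] [NormedSpace ℝ N]
  {N' : Type*} [NormedAddCommGroup N'] [NormedSpace ℝ N']
  [RiemannianBundle (fun x : X ↦ TangentSpace 𝓘(ℝ, E) x)]
  [IsContMDiffRiemannianBundle 𝓘(ℝ, E) ∞ E (fun x : X ↦ TangentSpace 𝓘(ℝ, E) x)]

lemma christoffel_add_right (x : X) (u v w : TangentSpace 𝓘(ℝ, E) x) :
    christoffel x u (v + w) = christoffel x u v + christoffel x u w := by
  refine ext_inner_right ℝ fun z ↦ ?_
  rw [inner_add_left]
  simp only [inner_christoffel, map_add, add_apply]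
  ring

lemma christoffel_smul_right (x : X) (r : ℝ) (u v : TangentSpace 𝓘(ℝ, E) x) :
    christoffel x u (r • v) = r • christoffel x u v := by
  refine ext_inner_right ℝ fun z ↦ ?_
  rw [inner_smul_left]
  simp only [inner_christoffel, map_smul, smul_apply, smul_eq_mul, conj_trivial]
  ring

lemma christoffel_smul_left (x : X) (r : ℝ) (u v : TangentSpace 𝓘(ℝ, E) x) :
    christoffel x (r • u) v = r • christoffel x u v := by
  rw [christoffel_symm, christoffel_smul_right, christoffel_symm]

lemma covDeriv_smul_direction {f : N → X} {p : N} (hf : ContinuousAt f p)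
    (V : ∀ q : N, TangentSpace 𝓘(ℝ, E) (f q)) (r : ℝ) (v : N) :
    covDeriv f V p (r • v : N) = r • covDeriv f V p v := by
  rw [covDeriv_eq hf, covDeriv_eq hf]
  simp only [map_smul]
  rw [christoffel_smul_left, smul_add]

lemma covDeriv_const_smul {f : N → X} {p : N} (hf : ContinuousAt f p)
    (V : ∀ q : N, TangentSpace 𝓘(ℝ, E) (f q)) (r : ℝ) (v : N) :
    covDeriv f (fun q ↦ r • V q) p v = r • covDeriv f V p v := by
  rw [covDeriv_eq hf, covDeriv_eq hf]
  have h : vecRep (f p) f (fun q ↦ r • V q) = r • vecRep (f p) f V := by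
    ext q; simp [vecRep]
  rw [h, fderiv_const_smul_field, christoffel_smul_right, smul_add]
  simp

/-- The covariant derivative of a vector field along `f`, restricted to a curve or map `c`. -/
lemma covDeriv_comp {f : N → X} {c : N' → N} {s : N'}
    (hf : MDifferentiableAt 𝓘(ℝ, N) 𝓘(ℝ, E) f (c s)) (hc : DifferentiableAt ℝ c s)
    {W : ∀ q : N, TangentSpace 𝓘(ℝ, E) (f q)}
    (hW : DifferentiableAt ℝ (vecRep (f (c s)) f W) (c s)) (v : N') :
    covDeriv (E := E) (f ∘ c) (fun t ↦ W (c t)) s v = covDeriv f W (c s) (fderiv ℝ c s v) := by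
  rw [covDeriv_eq (f := f ∘ c) (ContinuousAt.comp hf.continuousAt hc.continuousAt),
    covDeriv_eq hf.continuousAt, differential_comp hf hc]
  have h : vecRep ((f ∘ c) s) (f ∘ c) (fun t ↦ W (c t)) = vecRep (f (c s)) f W ∘ c := rfl
  rw [h, fderiv_comp s hW hc]
  rfl

section
variable [FiniteDimensional ℝ N] {U : Set N} (hU : IsOpen U) {Φ : N → X}
    (hΦ : ContMDiffOn 𝓘(ℝ, N) 𝓘(ℝ, E) ∞ Φ U) {y : N} (hy : y ∈ U)
include hU hΦ hy

lemma hess_add_right (u v w : N) :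
    hess (E := E) Φ y u (v + w) = hess Φ y u v + hess Φ y u w := by
  simp only [hess_eq hU hΦ hy, map_add, christoffel_add_right]
  abel

lemma hess_smul_right (r : ℝ) (u v : N) :
    hess (E := E) Φ y u (r • v) = r • hess Φ y u v := by
  simp only [hess_eq hU hΦ hy, map_smul, christoffel_smul_right, smul_add]

lemma hess_add_left (u v w : N) :
    hess (E := E) Φ y (u + v) w = hess Φ y u w + hess Φ y v w := by
  rw [hess_symm hU hΦ hy, hess_add_right hU hΦ hy, hess_symm hU hΦ hy w, hess_symm hU hΦ hy w]

lemma hess_smul_left (r : ℝ) (u v : N) :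
    hess (E := E) Φ y (r • u) v = r • hess Φ y u v := by
  rw [hess_symm hU hΦ hy, hess_smul_right hU hΦ hy, hess_symm hU hΦ hy]

end

end Linearity

/-! ### Geodesics of a hypersurface with planar extrinsic shape -/

section Immersion

variable {E : Type*} [NormedAddCommGroup E] [NormedSpace ℝ E] [FiniteDimensional ℝ E]
  {M : Type*} [TopologicalSpace M] [ChartedSpace E M] [IsManifold 𝓘(ℝ, E) ∞ M]
  [RiemannianBundle (fun x : M ↦ TangentSpace 𝓘(ℝ, E) x)]
  {F : Type*} [NormedAddCommGroup F] [NormedSpace ℝ F] [FiniteDimensional ℝ F]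
  {Q : Type*} [TopologicalSpace Q] [ChartedSpace F Q] [IsManifold 𝓘(ℝ, F) ∞ Q]
  [RiemannianBundle (fun x : Q ↦ TangentSpace 𝓘(ℝ, F) x)]
  {ι : M → Q}

lemma normalPart_smul (p : M) (r : ℝ) (v : TangentSpace 𝓘(ℝ, F) (ι p)) :
    normalPart (E := E) ι p (r • v) = r • normalPart (E := E) ι p v := by
  simp only [normalPart, tangentPart, map_smul, smul_sub]

lemma inner_normalPart {p : M} {Y : TangentSpace 𝓘(ℝ, F) (ι p)}
    (hY : Y ∈ normalSpace (E := E) ι p) (v : TangentSpace 𝓘(ℝ, F) (ι p)) :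
    inner ℝ Y (normalPart (E := E) ι p v) = inner ℝ Y v := by
  rw [normalPart, inner_sub_right, sub_eq_self]
  exact (Submodule.mem_orthogonal' _ _).1 hY _ (Submodule.starProjection_apply_mem _ _)

variable (hι : IsIsometricImmersion (E := E) (F := F) ι) {x₀ : M}
include hι

lemma finrank_normalSpace (hEF : Module.finrank ℝ F = Module.finrank ℝ E + 1) (p : M) :
    Module.finrank ℝ (normalSpace (E := E) (F := F) ι p) = 1 := by
  have h1 := Submodule.finrank_add_finrank_orthogonal (tangentRange (E := E) (F := F) ι p)
  have hinj : Function.Injective (mfderiv 𝓘(ℝ, E) 𝓘(ℝ, F) ι p).toLinearMap := by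
    refine (injective_iff_map_eq_zero _).2 fun x hx ↦ ?_
    have h := hι.2 p x x
    rw [show mfderiv 𝓘(ℝ, E) 𝓘(ℝ, F) ι p x = 0 from hx, inner_zero_left] at h
    exact inner_self_eq_zero.1 h.symm
  have h2 : Module.finrank ℝ (tangentRange (E := E) (F := F) ι p) = Module.finrank ℝ E :=
    LinearMap.finrank_range_of_inj hinj
  have h3 : Module.finrank ℝ (TangentSpace 𝓘(ℝ, F) (ι p)) = Module.finrank ℝ F := rfl
  have h4 : normalSpace (E := E) (F := F) ι p = (tangentRange (E := E) (F := F) ι p)ᗮ := rfl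
  rw [h4]
  omega

/-- In codimension one a unit normal vector spans the normal space. -/
lemma eq_inner_smul_of_mem_normalSpace (hEF : Module.finrank ℝ F = Module.finrank ℝ E + 1)
    {p : M} {Y x : TangentSpace 𝓘(ℝ, F) (ι p)} (hY : Y ∈ normalSpace (E := E) ι p)
    (hY1 : inner ℝ Y Y = (1 : ℝ)) (hx : x ∈ normalSpace (E := E) ι p) :
    x = (inner ℝ Y x : ℝ) • Y := by
  have hY0 : (⟨Y, hY⟩ : normalSpace (E := E) (F := F) ι p) ≠ 0 := by
    intro h
    have : Y = 0 := congrArg Subtype.val h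
    rw [this, inner_zero_left] at hY1
    exact zero_ne_one hY1
  obtain ⟨r, hr⟩ := exists_smul_eq_of_finrank_eq_one (finrank_normalSpace hι hEF p) hY0 ⟨x, hx⟩
  have hr' : r • Y = x := congrArg Subtype.val hr
  rw [← hr', inner_smul_right, hY1, mul_one]

variable [IsContMDiffRiemannianBundle 𝓘(ℝ, E) ∞ E (fun x : M ↦ TangentSpace 𝓘(ℝ, E) x)]
  [IsContMDiffRiemannianBundle 𝓘(ℝ, F) ∞ F (fun x : Q ↦ TangentSpace 𝓘(ℝ, F) x)]

/-- An isometric immersion preserves Christoffel symbols, because `ι ∘ chartParam E x₀` and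
`chartParam E x₀` pull back the same metric. -/
lemma metricChristoffel_immersion {y : E} (hy : y ∈ (extChartAt 𝓘(ℝ, E) x₀).target) (u v : E) :
    metricChristoffel (gram F (ι ∘ chartParam E x₀)) y u v =
      metricChristoffel (gram E (chartParam E x₀)) y u v := by
  have h : gram F (ι ∘ chartParam E x₀) =ᶠ[𝓝 y] gram E (chartParam E x₀) := by
    filter_upwards [(isOpen_extChartAt_target (I := 𝓘(ℝ, E)) x₀).mem_nhds hy] with z hz
    exact gram_immersion hι hz
  rw [metricChristoffel, metricChristoffel, h.fderiv_eq, h.eq_of_nhds]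

section Curve

variable {c : ℝ → E} {J : Set ℝ} (hJ : IsOpen J) (hcJ : ContDiffOn ℝ ∞ c J)
  (hcU : MapsTo c J (extChartAt 𝓘(ℝ, E) x₀).target)
  (hgeo : ∀ t ∈ J, deriv (deriv c) t =
    -metricChristoffel (gram E (chartParam E x₀)) (c t) (deriv c t) (deriv c t))
include hJ hcJ hcU

lemma velocity_immersion {t : ℝ} (ht : t ∈ J) :
    velocity (E := F) (ι ∘ chartParam E x₀ ∘ c) t =
      differential (E := F) (ι ∘ chartParam E x₀) (c t) (deriv c t) :=
  velocity_comp (Φ := ι ∘ chartParam E x₀)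
    (((contMDiffOn_immersion_chartParam (x₀ := x₀) hι).contMDiffAt
      ((isOpen_extChartAt_target x₀).mem_nhds (hcU ht))).mdifferentiableAt (by simp))
    ((hcJ.contDiffAt (hJ.mem_nhds ht)).differentiableAt (by simp))

include hgeo

/-- The acceleration of the extrinsic shape of a geodesic is normal: it is `α(γ', γ')`. -/
lemma covDerivCurve_velocity_immersion {t : ℝ} (ht : t ∈ J) :
    covDerivCurve (E := F) (ι ∘ chartParam E x₀ ∘ c) (velocity (ι ∘ chartParam E x₀ ∘ c)) t =
      normalPart (E := E) ι (chartParam E x₀ (c t))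
        (hess (ι ∘ chartParam E x₀) (c t) (deriv c t) (deriv c t)) := by
  have hU := isOpen_extChartAt_target (I := 𝓘(ℝ, E)) x₀
  have hf := contMDiffOn_immersion_chartParam (x₀ := x₀) hι
  have h1 := covDerivCurve_velocity hU hf hJ hcJ hcU ht
  have hn : hess (E := F) (ι ∘ chartParam E x₀) (c t) (deriv c t) (deriv c t) +
      differential (ι ∘ chartParam E x₀) (c t) (deriv (deriv c) t) ∈
      normalSpace (E := E) ι (chartParam E x₀ (c t)) := by
    refine (mem_normalSpace_iff hι (hcU ht)).2 fun w ↦ ?_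
    rw [real_inner_comm, inner_add_left, inner_hess_eq_gram hU hf (hcU ht)
      (injective_differential_immersion hι (hcU ht)), metricChristoffel_immersion hι (hcU ht),
      gram_immersion hι (hcU ht), ← gram_apply, hgeo t ht, gram_immersion hι (hcU ht), map_neg]
    exact add_neg_cancel _
  have h2 := normalPart_eq_self hn
  rw [normalPart_add, normalPart_differential hι (hcU ht), add_zero] at h2
  exact h1.trans h2.symm

variable {κ : ℝ → ℝ} (hκ : ContinuousOn κ J)
  (hpl : SatisfiesPlanarSystem (E := F) (ι ∘ chartParam E x₀ ∘ c) J κ)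
include hκ hpl

/-- If the extrinsic shape of a geodesic `γ` is planar, then `α(γ', w) = ⟨γ', w⟩ α(γ', γ')` where
`κ ≠ 0`. There `κ Y = α(γ', γ')` makes `Y` a unit normal field, and differentiating its
orthogonality to the tangential field `w` along `γ` gives `⟨Y, α(γ', w)⟩ = κ ⟨γ', w⟩`; in
codimension one this determines `α(γ', w)`. -/
lemma normalPart_hess_of_satisfiesPlanarSystem
    (hEF : Module.finrank ℝ F = Module.finrank ℝ E + 1) {t : ℝ} (ht : t ∈ J) (hκt : κ t ≠ 0)
    (w : E) :
    normalPart (E := E) ι (chartParam E x₀ (c t))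
        (hess (E := F) (ι ∘ chartParam E x₀) (c t) (deriv c t) w) =
      gram E (chartParam E x₀) (c t) (deriv c t) w •
        normalPart (E := E) ι (chartParam E x₀ (c t))
          (hess (E := F) (ι ∘ chartParam E x₀) (c t) (deriv c t) (deriv c t)) := by
  have hU := isOpen_extChartAt_target (I := 𝓘(ℝ, E)) x₀
  have hf := contMDiffOn_immersion_chartParam (x₀ := x₀) hι
  have hct : DifferentiableAt ℝ c t :=
    (hcJ.contDiffAt (hJ.mem_nhds ht)).differentiableAt (by simp)
  have hfd : MDifferentiableAt 𝓘(ℝ, E) 𝓘(ℝ, F) (ι ∘ chartParam E x₀) (c t) :=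
    (hf.contMDiffAt (hU.mem_nhds (hcU ht))).mdifferentiableAt (by simp)
  obtain ⟨-, Y, hYs, hY⟩ := hpl
  have hYn (s : ℝ) (hs : s ∈ J) (hκs : κ s ≠ 0) :
      (Y s : TangentSpace 𝓘(ℝ, F) (ι (chartParam E x₀ (c s)))) ∈
        normalSpace (E := E) ι (chartParam E x₀ (c s)) := by
    have h1 := (hY s hs).2.1.symm.trans (covDerivCurve_velocity_immersion hι hJ hcJ hcU hgeo hs)
    refine ((normalSpace (E := E) ι (chartParam E x₀ (c s))).smul_mem_iff hκs).1 ?_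
    exact Set.mem_of_eq_of_mem h1 (normalPart_mem _ _)
  have hYd : DifferentiableAt ℝ (vecRep ((ι ∘ chartParam E x₀ ∘ c) t)
      (ι ∘ chartParam E x₀ ∘ c) Y) t :=
    (contDiffAt_vecRep_of_contMDiffAt (hYs.contMDiffAt (hJ.mem_nhds ht))
      (mem_chart_source F _)).differentiableAt (by simp)
  have hWd : DifferentiableAt ℝ (vecRep ((ι ∘ chartParam E x₀ ∘ c) t)
      (ι ∘ chartParam E x₀ ∘ c)
      (fun s ↦ differential (E := F) (ι ∘ chartParam E x₀) (c s) w)) t :=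
    (hasFDerivAt_vecRep_differential hU hf (hcU ht) hct (V := fun _ ↦ w)
      (differentiableAt_const _) (mem_chart_source F _)).differentiableAt
  have hcov : covDeriv (E := F) (ι ∘ chartParam E x₀ ∘ c)
      (fun s ↦ differential (E := F) (ι ∘ chartParam E x₀) (c s) w) t (1 : ℝ) =
      hess (ι ∘ chartParam E x₀) (c t) (deriv c t) w := by
    have := covDerivCurve_differential hU hf (hcU ht) hct (V := fun _ ↦ w)
      (differentiableAt_const _)
    rw [deriv_const, map_zero, add_zero] at this
    exact this
  -- `κ` does not vanish near `t`, so that the orthogonality holds on a neighbourhood of `t`.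
  have h0 : (fun s ↦ inner ℝ (Y s) (differential (E := F) (ι ∘ chartParam E x₀) (c s) w))
      =ᶠ[𝓝 t] fun _ ↦ (0 : ℝ) := by
    filter_upwards [hJ.mem_nhds ht, (hκ.continuousAt (hJ.mem_nhds ht)).eventually_ne hκt]
      with s hs hκs
    rw [real_inner_comm]
    exact (mem_normalSpace_iff hι (hcU hs)).1 (hYn s hs hκs) w
  have hp := (fderiv_inner_eq_covDeriv (f := ι ∘ chartParam E x₀ ∘ c)
    (hfd.comp t hct.mdifferentiableAt) hYd hWd).2 1
  rw [h0.fderiv_eq, fderiv_const_apply, hcov] at hp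
  have hY' : covDeriv (E := F) (ι ∘ chartParam E x₀ ∘ c) Y t (1 : ℝ) =
      -(κ t • differential (E := F) (ι ∘ chartParam E x₀) (c t) (deriv c t)) :=
    (hY t ht).2.2.trans (congrArg (fun z : TangentSpace 𝓘(ℝ, F) (ι (chartParam E x₀ (c t))) ↦
      -(κ t • z)) (velocity_immersion hι hJ hcJ hcU ht))
  have hYh : inner ℝ (Y t : TangentSpace 𝓘(ℝ, F) (ι (chartParam E x₀ (c t))))
      (hess (ι ∘ chartParam E x₀) (c t) (deriv c t) w) =
      κ t * gram E (chartParam E x₀) (c t) (deriv c t) w := by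
    have h1 : inner ℝ (-(κ t • differential (E := F) (ι ∘ chartParam E x₀) (c t) (deriv c t)))
        (differential (E := F) (ι ∘ chartParam E x₀) (c t) w) =
        -(κ t * gram E (chartParam E x₀) (c t) (deriv c t) w) := by
      rw [inner_neg_left, real_inner_smul_left, ← gram_apply, gram_immersion hι (hcU ht)]
    have h2 : (0 : ℝ) = -(κ t * gram E (chartParam E x₀) (c t) (deriv c t) w) +
        inner ℝ (Y t : TangentSpace 𝓘(ℝ, F) (ι (chartParam E x₀ (c t))))
          (hess (ι ∘ chartParam E x₀) (c t) (deriv c t) w) := by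
      rw [← h1]
      exact hp.trans (congrArg (fun z : TangentSpace 𝓘(ℝ, F) (ι (chartParam E x₀ (c t))) ↦
        inner ℝ z (differential (E := F) (ι ∘ chartParam E x₀) (c t) w) +
        inner ℝ (Y t : TangentSpace 𝓘(ℝ, F) (ι (chartParam E x₀ (c t))))
          (hess (ι ∘ chartParam E x₀) (c t) (deriv c t) w)) hY')
    linarith
  have hYt := hYn t ht hκt
  have h3 := eq_inner_smul_of_mem_normalSpace hι hEF hYt (hY t ht).1
    (normalPart_mem (E := E) (ι := ι) (chartParam E x₀ (c t))
      (hess (E := F) (ι ∘ chartParam E x₀) (c t) (deriv c t) w))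
  have h4 : normalPart (E := E) ι (chartParam E x₀ (c t))
      (hess (ι ∘ chartParam E x₀) (c t) (deriv c t) (deriv c t)) =
      κ t • (Y t : TangentSpace 𝓘(ℝ, F) (ι (chartParam E x₀ (c t)))) :=
    (covDerivCurve_velocity_immersion hι hJ hcJ hcU hgeo ht).symm.trans (hY t ht).2.1
  rw [h3, inner_normalPart hYt, hYh, h4, smul_smul, mul_comm]

end Curve

end Immersion

/-! ### Umbilicity and extrinsic spheres -/

lemma IsCircleOn.isPlanarOn {F : Type*} [NormedAddCommGroup F] [NormedSpace ℝ F]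
    [FiniteDimensional ℝ F] {Q : Type*} [TopologicalSpace Q] [ChartedSpace F Q]
    [IsManifold 𝓘(ℝ, F) ∞ Q] [RiemannianBundle (fun x : Q ↦ TangentSpace 𝓘(ℝ, F) x)]
    {γ : ℝ → Q} {J : Set ℝ} (h : IsCircleOn (E := F) γ J) : IsPlanarOn (E := F) γ J := by
  obtain ⟨κ, -, h⟩ := h
  exact ⟨fun _ ↦ κ, contDiffOn_const, h⟩

section Immersion

variable {E : Type*} [NormedAddCommGroup E] [NormedSpace ℝ E] [FiniteDimensional ℝ E]
  {M : Type*} [TopologicalSpace M] [ChartedSpace E M] [IsManifold 𝓘(ℝ, E) ∞ M]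
  [RiemannianBundle (fun x : M ↦ TangentSpace 𝓘(ℝ, E) x)]
  {F : Type*} [NormedAddCommGroup F] [NormedSpace ℝ F] [FiniteDimensional ℝ F]
  {Q : Type*} [TopologicalSpace Q] [ChartedSpace F Q] [IsManifold 𝓘(ℝ, F) ∞ Q]
  [RiemannianBundle (fun x : Q ↦ TangentSpace 𝓘(ℝ, F) x)]
  {x₀ : M} {y : E}

lemma gram_chartParam_pos (hy : y ∈ (extChartAt 𝓘(ℝ, E) x₀).target) {u : E} (hu : u ≠ 0) :
    0 < gram E (chartParam E x₀) y u u := by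
  rw [gram_apply]
  exact real_inner_self_pos.2 fun h ↦
    hu ((bijective_differential_chartParam hy).1 (by rw [h, map_zero]))

/-- A nonzero vector is a positive multiple of one that has unit length in the metric of `M`. -/
lemma exists_eq_smul_unit (hy : y ∈ (extChartAt 𝓘(ℝ, E) x₀).target) {u : E} (hu : u ≠ 0) :
    ∃ r : ℝ, ∃ v : E, 0 < r ∧ u = r • v ∧ gram E (chartParam E x₀) y v v = 1 := by
  have h := gram_chartParam_pos hy hu
  have hs := Real.sqrt_pos.2 h
  refine ⟨√(gram E (chartParam E x₀) y u u), (√(gram E (chartParam E x₀) y u u))⁻¹ • u, hs, ?_, ?_⟩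
  · rw [smul_smul, mul_inv_cancel₀ hs.ne', one_smul]
  · simp only [map_smul, smul_apply, smul_eq_mul]
    rw [← mul_assoc, ← mul_inv, Real.mul_self_sqrt h.le, inv_mul_cancel₀ h.ne']

variable {ι : M → Q} (hι : IsIsometricImmersion (E := E) (F := F) ι)
  [IsContMDiffRiemannianBundle 𝓘(ℝ, E) ∞ E (fun x : M ↦ TangentSpace 𝓘(ℝ, E) x)]
  [IsContMDiffRiemannianBundle 𝓘(ℝ, F) ∞ F (fun x : Q ↦ TangentSpace 𝓘(ℝ, F) x)]
  (hEF : Module.finrank ℝ F = Module.finrank ℝ E + 1)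
include hι hEF

section Planar

variable (hpl : ∀ (γ : ℝ → M) (J : Set ℝ), IsOpen J → J.OrdConnected →
    IsGeodesicOn (E := E) γ J → IsPlanarOn (E := F) (ι ∘ γ) J)
include hpl

/-- The conjugacy relation `α(v, w) = ⟨v, w⟩ α(v, v)` for a unit vector `v` with `α(v, v) ≠ 0`, from
the geodesic with initial velocity `v`. -/
lemma normalPart_hess_of_unit (hy : y ∈ (extChartAt 𝓘(ℝ, E) x₀).target) {v : E}
    (hv : gram E (chartParam E x₀) y v v = 1)
    (hne : normalPart (E := E) ι (chartParam E x₀ y)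
      (hess (E := F) (ι ∘ chartParam E x₀) y v v) ≠ 0) (w : E) :
    normalPart (E := E) ι (chartParam E x₀ y) (hess (E := F) (ι ∘ chartParam E x₀) y v w) =
      gram E (chartParam E x₀) y v w • normalPart (E := E) ι (chartParam E x₀ y)
        (hess (E := F) (ι ∘ chartParam E x₀) y v v) := by
  obtain ⟨ε, hε, c, rfl, rfl, hc, hcU, hg, hgeo⟩ := exists_geodesic hy hv
  obtain ⟨κ, hκ, hsys⟩ := hpl _ _ isOpen_Ioo ordConnected_Ioo hgeo
  have h0 : (0 : ℝ) ∈ Ioo (-ε) ε := ⟨by linarith, hε⟩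
  refine normalPart_hess_of_satisfiesPlanarSystem hι isOpen_Ioo hc hcU hg hκ.continuousOn hsys hEF
    h0 (fun hκ0 ↦ hne ?_) w
  obtain ⟨-, Y, -, hY⟩ := hsys
  refine (covDerivCurve_velocity_immersion hι isOpen_Ioo hc hcU hg h0).symm.trans
    ((hY 0 h0).2.1.trans ?_)
  rw [hκ0]
  exact zero_smul ℝ _

/-- If the geodesics of a hypersurface have planar extrinsic shape, then at each point
`α(x, y) = ⟨x, y⟩ H` for some normal vector `H`. -/
theorem exists_normalPart_hess_eq (hy : y ∈ (extChartAt 𝓘(ℝ, E) x₀).target) :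
    ∃ H ∈ normalSpace (E := E) (F := F) ι (chartParam E x₀ y), ∀ u w,
      normalPart (E := E) ι (chartParam E x₀ y) (hess (E := F) (ι ∘ chartParam E x₀) y u w) =
        gram E (chartParam E x₀) y u w • H := by
  have hU := isOpen_extChartAt_target (I := 𝓘(ℝ, E)) x₀
  have hf := contMDiffOn_immersion_chartParam (x₀ := x₀) hι
  let g : E →ₗ[ℝ] E →ₗ[ℝ] ℝ := LinearMap.mk₂ ℝ (fun u w ↦ gram E (chartParam E x₀) y u w)
    (by simp) (by simp) (by simp) (by simp)
  let h : E →ₗ[ℝ] E →ₗ[ℝ] TangentSpace 𝓘(ℝ, F) (ι (chartParam E x₀ y)) :=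
    LinearMap.mk₂ ℝ (fun u w ↦ normalPart (E := E) ι (chartParam E x₀ y)
      (hess (E := F) (ι ∘ chartParam E x₀) y u w))
      (fun u v w ↦ by rw [hess_add_left hU hf hy]; exact normalPart_add _ _ _)
      (fun r u w ↦ by rw [hess_smul_left hU hf hy]; exact normalPart_smul _ _ _)
      (fun u v w ↦ by rw [hess_add_right hU hf hy]; exact normalPart_add _ _ _)
      (fun r u w ↦ by rw [hess_smul_right hU hf hy]; exact normalPart_smul _ _ _)
  have hgs : ∀ u v, g u v = g v u := fun u v ↦ by
    simp only [g, LinearMap.mk₂_apply, gram_apply, real_inner_comm]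
  have hhs : ∀ u v, h u v = h v u := fun u v ↦
    congrArg (fun z ↦ normalPart (E := E) ι (chartParam E x₀ y) z) (hess_symm hU hf hy u v)
  have hP : ∀ v, h v v ≠ 0 → ∀ w, g v v • h v w = g v w • h v v := by
    intro u hu w
    have hu0 : u ≠ 0 := fun h0 ↦ hu (by rw [h0, map_zero])
    obtain ⟨r, v, hr, rfl, hv⟩ := exists_eq_smul_unit hy hu0
    simp only [map_smul, LinearMap.smul_apply] at hu ⊢
    have hv' : g v v = 1 := hv
    have h1 : h v v ≠ 0 := fun h0 ↦ hu (by rw [h0, smul_zero, smul_zero])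
    have h2 : h v w = g v w • h v v := normalPart_hess_of_unit hι hEF hpl hy hv h1 w
    rw [h2, hv']
    module
  obtain ⟨H, hH⟩ := exists_eq_smul_of_forall_smul_eq g h hgs
    (fun v hv ↦ gram_chartParam_pos hy hv) hhs hP
  -- If `E` is zero, `H` is arbitrary; projecting makes it normal in any case.
  refine ⟨normalPart (E := E) ι (chartParam E x₀ y) H, normalPart_mem _ _, fun u w ↦ ?_⟩
  have h1 : normalPart (E := E) ι (chartParam E x₀ y) (hess (E := F) (ι ∘ chartParam E x₀) y u w) =
      gram E (chartParam E x₀) y u w • H := hH u w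
  rw [← normalPart_smul, ← h1]
  exact (normalPart_eq_self (normalPart_mem _ _)).symm

theorem isTotallyUmbilic_of_isPlanarOn : IsTotallyUmbilic E F ι := by
  intro p η hη
  obtain ⟨x₀, y, hy, rfl⟩ := exists_chartParam_eq (E := E) p
  obtain ⟨H, hH, hα⟩ := exists_normalPart_hess_eq hι hEF hpl hy
  refine ⟨-inner ℝ η H, fun x ↦ ?_⟩
  obtain ⟨u, rfl⟩ := (bijective_differential_chartParam hy).2 x
  rw [← differential_immersion hι hy]
  obtain ⟨a, ha⟩ := (mem_tangentRange_iff hι hy).1 (Submodule.starProjection_apply_mem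
    (tangentRange (E := E) ι (chartParam E x₀ y)) (covDeriv ι (fun q ↦ normalPart (E := E) ι q
      (FiberBundle.extend F η (ι q))) (chartParam E x₀ y)
      (differential (E := E) (chartParam E x₀) y u)))
  have hs : shapeOperator ι (chartParam E x₀ y) η
      (differential (E := E) (chartParam E x₀) y u) =
    differential (E := F) (ι ∘ chartParam E x₀) y a := ha.symm
  have hinner : ∀ w, inner ℝ (differential (E := F) (ι ∘ chartParam E x₀) y a)
      (differential (E := F) (ι ∘ chartParam E x₀) y w) =
      inner ℝ ((-inner ℝ η H : ℝ) • differential (E := F) (ι ∘ chartParam E x₀) y u)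
      (differential (E := F) (ι ∘ chartParam E x₀) y w) := by
    intro w
    have h1 := inner_shapeOperator hι hy hη u w
    rw [hs, ← inner_normalPart hη, hα, inner_smul_right] at h1
    rw [real_inner_smul_left, ← gram_apply, ← gram_apply, gram_immersion hι hy]
    rw [← gram_apply, gram_immersion hι hy] at h1
    rw [h1]
    ring
  have hz := hinner (a - (-inner ℝ η H : ℝ) • u)
  rw [← sub_eq_zero, ← inner_sub_left, map_sub, map_smul, inner_self_eq_zero, sub_eq_zero] at hz
  exact hs.trans hz

variable [Nontrivial E]

/-- The vector `H` with `α(x, y) = ⟨x, y⟩ H` is the mean curvature vector. -/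
lemma gram_smul_meanCurvature (hy : y ∈ (extChartAt 𝓘(ℝ, E) x₀).target) (u w : E) :
    gram E (chartParam E x₀) y u w • meanCurvature (E := E) (F := F) ι (chartParam E x₀ y) =
      normalPart (E := E) ι (chartParam E x₀ y)
        (hess (E := F) (ι ∘ chartParam E x₀) y u w) := by
  obtain ⟨H, -, hα⟩ := exists_normalPart_hess_eq hι hEF hpl hy
  suffices h : meanCurvature (E := E) (F := F) ι (chartParam E x₀ y) = H by rw [h, hα]
  have h1 : ∀ i, secondFundamentalForm (F := F) ι (chartParam E x₀ y)
      (stdOrthonormalBasis ℝ (TangentSpace 𝓘(ℝ, E) (chartParam E x₀ y)) i)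
      (stdOrthonormalBasis ℝ (TangentSpace 𝓘(ℝ, E) (chartParam E x₀ y)) i) = H := by
    intro i
    set b := stdOrthonormalBasis ℝ (TangentSpace 𝓘(ℝ, E) (chartParam E x₀ y)) with hb
    obtain ⟨u, hu⟩ := (bijective_differential_chartParam hy).2 (b i)
    have h2 : gram E (chartParam E x₀) y u u = 1 := by
      rw [gram_apply, hu, real_inner_self_eq_norm_sq, b.orthonormal.1 i, one_pow]
    rw [← hu, secondFundamentalForm_eq hι hy, hα, h2, one_smul]
  have h3 : (Module.finrank ℝ E : ℝ) ≠ 0 := by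
    exact_mod_cast (Module.finrank_pos (R := ℝ) (M := E)).ne'
  have h4 : Module.finrank ℝ (TangentSpace 𝓘(ℝ, E) (chartParam E x₀ y)) = Module.finrank ℝ E := rfl
  rw [meanCurvature, Finset.sum_congr rfl fun i _ ↦ h1 i, Finset.sum_const, Finset.card_univ,
    Fintype.card_fin, h4, ← Nat.cast_smul_eq_nsmul ℝ, smul_smul, inv_mul_cancel₀ h3, one_smul]

/-- The mean curvature vector field is smooth, being `α(u, u) / ⟨u, u⟩` for a constant vector field
`u` in a chart. This makes its covariant derivative meaningful, and allows for the chain rule. -/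
lemma contDiffAt_vecRep_meanCurvature (hy : y ∈ (extChartAt 𝓘(ℝ, E) x₀).target) :
    ContDiffAt ℝ ∞ (vecRep (E := F) ((ι ∘ chartParam E x₀) y) (ι ∘ chartParam E x₀)
      (fun z ↦ meanCurvature (E := E) (F := F) ι (chartParam E x₀ z))) y := by
  have hU := isOpen_extChartAt_target (I := 𝓘(ℝ, E)) x₀
  have hf := contMDiffOn_immersion_chartParam (x₀ := x₀) hι
  have hx := mem_chart_source F ((ι ∘ chartParam E x₀) y)
  obtain ⟨u, hu⟩ := exists_ne (0 : E)
  have hg : ContDiffAt ℝ ∞ (fun z ↦ (gram E (chartParam E x₀) z u u)⁻¹) y :=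
    (((contDiffAt_gram hU (contMDiffOn_chartParam x₀) hy).clm_apply contDiffAt_const).clm_apply
      contDiffAt_const).inv (gram_chartParam_pos hy hu).ne'
  have hn := contDiffAt_vecRep_normalPart hι hy hx
    (V := fun z ↦ hess (ι ∘ chartParam E x₀) z u u) (contDiffAt_toCoord_hess hU hf hy hx u u)
  refine (hg.smul hn).congr_of_eventuallyEq ?_
  filter_upwards [hU.mem_nhds hy] with z hz
  simp only [vecRep, Pi.smul_apply']
  rw [← map_smul]
  refine congrArg _ ?_
  rw [← gram_smul_meanCurvature hι hEF hpl hz, smul_smul,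
    inv_mul_cancel₀ (gram_chartParam_pos hz hu).ne', one_smul]

end Planar

section Circle

variable (hci : ∀ (γ : ℝ → M) (J : Set ℝ), IsOpen J → J.OrdConnected →
    IsGeodesicOn (E := E) γ J → IsCircleOn (E := F) (ι ∘ γ) J) [Nontrivial E]
include hci

/-- Along the geodesic with initial velocity `v` the mean curvature vector is `α(γ', γ') = κ Y`,
with `κ` constant, so that its covariant derivative `-κ² T` is tangential. -/
lemma normalPart_covDeriv_meanCurvature (hy : y ∈ (extChartAt 𝓘(ℝ, E) x₀).target) {v : E}
    (hv : gram E (chartParam E x₀) y v v = 1) :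
    normalPart (E := E) ι (chartParam E x₀ y) (covDeriv (E := F) (ι ∘ chartParam E x₀)
      (fun z ↦ meanCurvature (E := E) (F := F) ι (chartParam E x₀ z)) y v) = 0 := by
  have hU := isOpen_extChartAt_target (I := 𝓘(ℝ, E)) x₀
  have hf := contMDiffOn_immersion_chartParam (x₀ := x₀) hι
  have hpl := fun γ J hJ hJ' hγ ↦ (hci γ J hJ hJ' hγ).isPlanarOn
  obtain ⟨ε, hε, c, rfl, rfl, hc, hcU, hg, hgeo⟩ := exists_geodesic hy hv
  obtain ⟨κ, hκ, hsp, Y, hYs, hY⟩ := hci _ _ isOpen_Ioo ordConnected_Ioo hgeo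
  have h0 : (0 : ℝ) ∈ Ioo (-ε) ε := ⟨by linarith, hε⟩
  have hc0 : DifferentiableAt ℝ c 0 :=
    (hc.contDiffAt (isOpen_Ioo.mem_nhds h0)).differentiableAt (by simp)
  have hfd : MDifferentiableAt 𝓘(ℝ, E) 𝓘(ℝ, F) (ι ∘ chartParam E x₀) (c 0) :=
    (hf.contMDiffAt (hU.mem_nhds hy)).mdifferentiableAt (by simp)
  have hHY : ∀ t ∈ Ioo (-ε) ε, meanCurvature (E := E) (F := F) ι (chartParam E x₀ (c t)) =
      κ • (Y t : TangentSpace 𝓘(ℝ, F) (ι (chartParam E x₀ (c t)))) := by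
    intro t ht
    have h1 : gram E (chartParam E x₀) (c t) (deriv c t) (deriv c t) = 1 := by
      rw [← gram_immersion hι (hcU ht), gram_apply,
        ← velocity_immersion hι isOpen_Ioo hc hcU ht]
      exact hsp.2 t ht
    have h2 := gram_smul_meanCurvature hι hEF hpl (hcU ht) (deriv c t) (deriv c t)
    rw [h1, one_smul] at h2
    exact h2.trans ((covDerivCurve_velocity_immersion hι isOpen_Ioo hc hcU hg ht).symm.trans
      (hY t ht).2.1)
  have hchain := covDeriv_comp hfd hc0
    ((contDiffAt_vecRep_meanCurvature hι hEF hpl hy).differentiableAt (by simp)) (1 : ℝ)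
  have hcongr : covDeriv (E := F) (ι ∘ chartParam E x₀ ∘ c)
      (fun t ↦ meanCurvature (E := E) (F := F) ι (chartParam E x₀ (c t))) 0 (1 : ℝ) =
      covDeriv (E := F) (ι ∘ chartParam E x₀ ∘ c) (fun t ↦ κ • Y t) 0 (1 : ℝ) := by
    refine covDeriv_congr ?_ _
    filter_upwards [isOpen_Ioo.mem_nhds h0] with t ht using hHY t ht
  have hsmul := covDeriv_const_smul (E := F) (f := ι ∘ chartParam E x₀ ∘ c) (p := (0 : ℝ))
    (hfd.continuousAt.comp hc0.continuousAt) Y κ (1 : ℝ)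
  have hfin : covDeriv (E := F) (ι ∘ chartParam E x₀)
      (fun z ↦ meanCurvature (E := E) (F := F) ι (chartParam E x₀ z)) (c 0) (deriv c 0) =
      differential (E := F) (ι ∘ chartParam E x₀) (c 0) (-(κ * κ) • deriv c 0) := by
    refine hchain.symm.trans (hcongr.trans (hsmul.trans ?_))
    have h3 : covDeriv (E := F) (ι ∘ chartParam E x₀ ∘ c) Y (0 : ℝ) (1 : ℝ) =
        -(κ • differential (E := F) (ι ∘ chartParam E x₀) (c 0) (deriv c 0)) :=
      (hY 0 h0).2.2.trans (congrArg
        (fun z : TangentSpace 𝓘(ℝ, F) (ι (chartParam E x₀ (c 0))) ↦ -(κ • z))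
        (velocity_immersion hι isOpen_Ioo hc hcU h0))
    refine (congrArg (fun z : TangentSpace 𝓘(ℝ, F) (ι (chartParam E x₀ (c 0))) ↦ κ • z) h3).trans ?_
    rw [map_smul, smul_neg, smul_smul, neg_smul]
  exact (congrArg (fun z ↦ normalPart (E := E) ι (chartParam E x₀ (c 0)) z) hfin).trans
    (normalPart_differential hι hy _)

theorem isExtrinsicSphere_of_isCircleOn : IsExtrinsicSphere E F ι := by
  have hpl := fun γ J hJ hJ' hγ ↦ (hci γ J hJ hJ' hγ).isPlanarOn
  refine ⟨isTotallyUmbilic_of_isPlanarOn hι hEF hpl, fun p x ↦ ?_⟩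
  obtain ⟨x₀, y, hy, rfl⟩ := exists_chartParam_eq (E := E) p
  obtain ⟨u, rfl⟩ := (bijective_differential_chartParam hy).2 x
  have hf := (contMDiffOn_immersion_chartParam (x₀ := x₀) hι).contMDiffAt
    ((isOpen_extChartAt_target (I := 𝓘(ℝ, E)) x₀).mem_nhds hy)
  have hd := (contDiffAt_vecRep_meanCurvature hι hEF hpl hy).differentiableAt (by simp)
  rw [normalCovDeriv, covDeriv_immersion hι hy hd]
  obtain ⟨r, v, rfl, hv⟩ : ∃ r : ℝ, ∃ v : E, u = r • v ∧
      gram E (chartParam E x₀) y v v = 1 := by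
    obtain ⟨u₁, hu₁⟩ := exists_ne (0 : E)
    by_cases hu : u = 0
    -- The zero vector is `0` times any unit vector.
    · obtain ⟨r, v, -, -, hv⟩ := exists_eq_smul_unit hy hu₁
      exact ⟨0, v, by rw [hu, zero_smul], hv⟩
    · obtain ⟨r, v, -, h, hv⟩ := exists_eq_smul_unit hy hu
      exact ⟨r, v, h, hv⟩
  rw [covDeriv_smul_direction hf.continuousAt]
  refine (normalPart_smul _ _ _).trans ?_
  rw [normalPart_covDeriv_meanCurvature hι hEF hci hy hv, smul_zero]

theorem not_isTotallyGeodesic_of_isCircleOn [Nonempty M] : ¬ IsTotallyGeodesic E F ι := by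
  intro htg
  obtain ⟨p⟩ := ‹Nonempty M›
  obtain ⟨x₀, y, hy, rfl⟩ := exists_chartParam_eq (E := E) p
  obtain ⟨u, hu⟩ := exists_ne (0 : E)
  obtain ⟨r, v, -, -, hv⟩ := exists_eq_smul_unit hy hu
  obtain ⟨ε, hε, c, rfl, rfl, hc, hcU, hg, hgeo⟩ := exists_geodesic hy hv
  obtain ⟨κ, hκ, -, Y, -, hY⟩ := hci _ _ isOpen_Ioo ordConnected_Ioo hgeo
  have h0 : (0 : ℝ) ∈ Ioo (-ε) ε := ⟨by linarith, hε⟩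
  have h1 := htg _ (differential (E := E) (chartParam E x₀) (c 0) (deriv c 0))
    (differential (E := E) (chartParam E x₀) (c 0) (deriv c 0))
  rw [secondFundamentalForm_eq hι hy] at h1
  have h2 := (hY 0 h0).2.1.symm.trans
    ((covDerivCurve_velocity_immersion hι isOpen_Ioo hc hcU hg h0).trans h1)
  have h3 : Y 0 = 0 := (smul_eq_zero.1 h2).resolve_left hκ.ne'
  have h4 := (hY 0 h0).1
  rw [h3, inner_zero_left] at h4
  exact zero_ne_one h4

end Circle

end Immersion

end PlanarGeodesics

end

theorem theorem1p5 {m : ℕ} (hm : 1 ≤ m)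
    {M : Type*} [TopologicalSpace M] [T2Space M] [SecondCountableTopology M] [Nonempty M]
    [ChartedSpace (EuclideanSpace ℝ (Fin m)) M]
    [IsManifold 𝓘(ℝ, EuclideanSpace ℝ (Fin m)) ∞ M]
    [RiemannianBundle (fun x : M ↦ TangentSpace 𝓘(ℝ, EuclideanSpace ℝ (Fin m)) x)]
    [IsContMDiffRiemannianBundle 𝓘(ℝ, EuclideanSpace ℝ (Fin m)) ∞ (EuclideanSpace ℝ (Fin m))
      (fun x : M ↦ TangentSpace 𝓘(ℝ, EuclideanSpace ℝ (Fin m)) x)]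
    {Q : Type*} [TopologicalSpace Q] [T2Space Q] [SecondCountableTopology Q]
    [ChartedSpace (EuclideanSpace ℝ (Fin (m + 1))) Q]
    [IsManifold 𝓘(ℝ, EuclideanSpace ℝ (Fin (m + 1))) ∞ Q]
    [RiemannianBundle (fun x : Q ↦ TangentSpace 𝓘(ℝ, EuclideanSpace ℝ (Fin (m + 1))) x)]
    [IsContMDiffRiemannianBundle 𝓘(ℝ, EuclideanSpace ℝ (Fin (m + 1))) ∞
      (EuclideanSpace ℝ (Fin (m + 1)))
      (fun x : Q ↦ TangentSpace 𝓘(ℝ, EuclideanSpace ℝ (Fin (m + 1))) x)]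
    (ι : M → Q)
    (hι : PlanarGeodesics.IsIsometricImmersion (E := EuclideanSpace ℝ (Fin m))
      (F := EuclideanSpace ℝ (Fin (m + 1))) ι) :
    ((∀ (γ : ℝ → M) (J : Set ℝ), IsOpen J → J.OrdConnected →
        PlanarGeodesics.IsGeodesicOn (E := EuclideanSpace ℝ (Fin m)) γ J →
        PlanarGeodesics.IsPlanarOn (E := EuclideanSpace ℝ (Fin (m + 1))) (ι ∘ γ) J) →
      PlanarGeodesics.IsTotallyUmbilic (EuclideanSpace ℝ (Fin m))
        (EuclideanSpace ℝ (Fin (m + 1))) ι) ∧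
    ((∀ (γ : ℝ → M) (J : Set ℝ), IsOpen J → J.OrdConnected →
        PlanarGeodesics.IsGeodesicOn (E := EuclideanSpace ℝ (Fin m)) γ J →
        PlanarGeodesics.IsCircleOn (E := EuclideanSpace ℝ (Fin (m + 1))) (ι ∘ γ) J) →
      PlanarGeodesics.IsExtrinsicSphere (EuclideanSpace ℝ (Fin m))
        (EuclideanSpace ℝ (Fin (m + 1))) ι ∧
      ¬ PlanarGeodesics.IsTotallyGeodesic (EuclideanSpace ℝ (Fin m))
        (EuclideanSpace ℝ (Fin (m + 1))) ι) := by
  have hEF : Module.finrank ℝ (EuclideanSpace ℝ (Fin (m + 1))) =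
      Module.finrank ℝ (EuclideanSpace ℝ (Fin m)) + 1 := by
    rw [finrank_euclideanSpace_fin, finrank_euclideanSpace_fin]
  have : Nontrivial (EuclideanSpace ℝ (Fin m)) :=
    Module.nontrivial_of_finrank_pos (R := ℝ) (by rw [finrank_euclideanSpace_fin]; omega)
  exact ⟨PlanarGeodesics.isTotallyUmbilic_of_isPlanarOn hι hEF, fun hci ↦
    ⟨PlanarGeodesics.isExtrinsicSphere_of_isCircleOn hι hEF hci,
      PlanarGeodesics.not_isTotallyGeodesic_of_isCircleOn hι hEF hci⟩⟩
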